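/- For real or complex random variables $Z_1,\dots,Z_r$ ($r\ge 1$) whose mixed moments exist, let $$\kappa(Z_1,\dots,Z_r)=\sum_{\{B_1,\dots,B_t\}}(-1)^{t+1}(t-1)!\prod_{u=1}^t \mathbb{E}\Bigl(\prod_{i\in B_u}Z_i\Bigr)$$ be their mixed cumulant, the sum being over all partitions of $\{1,\dots,r\}$ into nonempty blocks, and let $\kappa_r(Z)=\kappa(Z,\dots,Z)$ ($r$ copies). **Theorem 2.4.** Let $n\ge 1$, $r\ge 1$ and $\hat\ell\ge 2$ be integers. For $1\le j\le k\le n$ let $Y_{jk}$ be real random variables on a common probability space that have a joint (possibly degenerate) Gaussian distribution with mean $0$ and, for a constant $A$, $$|\operatorname{Cov}(Y_{jk},Y_{uv})|\le\begin{cases}A, & \text{if } \{j,k\}\cap\{u,v\}\ne\emptyset,\\ A/n, & \text{if } \{j,k\}\cap\{u,v\}=\emptyset.\end{cases}$$ Consider $$Y=\sum_{j=1}^n c^{(1)}_{jj}Y_{jj}+\sum_{1\le j\le k\le n}c^{(2)}_{jk}Y_{jk}^2+\sum_{\ell=3}^{\hat\ell}\ \sum_{1\le j<k\le n}c^{(\ell)}_{jk}Y_{jk}^\ell,$$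 where the coefficients are complex numbers and $C_1,\dots,C_{\hat\ell}$ are real numbers with $|c^{(1)}_{jj}|\le nC_1$ and $|c^{(2)}_{jj}|\le nC_2$ for $1\le j\le n$; $|c^{(2)}_{jk}|\le C_2$ for $1\le j<k\le n$; and $|c^{(\ell)}_{jk}|\le C_\ell$ for $1\le j<k\le n$ and $3\le\ell\le\hat\ell$. Suppose that $r$ and $\hat\ell$ are bounded, say $r\le R$ and $\hat\ell\le L_0$. Then $$|\kappa_r(Y)|\le K\,n^{r+1}\max_{\ell_1,\dots,\ell_r}\bigl(C_{\ell_1}\cdots C_{\ell_r}\bigr),$$ where the maximum is over all integers $\ell_1,\dots,\ell_r$ with $1\le\ell_1,\dots,\ell_r\le\hat\ell$ and $\ell_1+\cdots+\ell_r$ even, and the constant $K$ depends only on $R$, $L_0$ and $A$. -/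

import Mathlib

open MeasureTheory ProbabilityTheory

open scoped Nat

/-- Index pairs `(j, k)` with `1 ≤ j ≤ k ≤ n` (indices are shifted to `0, …, n - 1`). -/
abbrev PairIdx (n : ℕ) : Type := {p : Fin n × Fin n // p.1 ≤ p.2}

/-- The diagonal pair `(j, j)`. -/
def PairIdx.diag {n : ℕ} (j : Fin n) : PairIdx n := ⟨(j, j), le_rfl⟩

/-- The set `{j, k}` of a pair `(j, k)`. -/
def PairIdx.verts {n : ℕ} (p : PairIdx n) : Finset (Fin n) := {p.1.1, p.1.2}

/-- The mixed cumulant `κ(Z₁, …, Z_r)`, for `r ≥ 1`, of complex random variables whose mixed moments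
exist: the sum over all partitions `{B₁, …, B_t}` of the index set of
`(-1) ^ (t + 1) * (t - 1)! * ∏ᵤ 𝔼 (∏_{i ∈ Bᵤ} Z_i)`. -/
noncomputable def mixedCumulant {Ω : Type*} [MeasurableSpace Ω] (P : Measure Ω) {r : ℕ}
    (Z : Fin r → Ω → ℂ) : ℂ :=
  ∑ π : Finpartition (Finset.univ : Finset (Fin r)),
    (-1 : ℂ) ^ (π.parts.card + 1) * ((π.parts.card - 1)! : ℂ) *
      ∏ B ∈ π.parts, ∫ ω, ∏ i ∈ B, Z i ω ∂P

/-- The cumulant `κ_r(Z) = κ(Z, …, Z)` (with `r ≥ 1` copies of `Z`). -/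
noncomputable def cumulant {Ω : Type*} [MeasurableSpace Ω] (P : Measure Ω) (r : ℕ)
    (Z : Ω → ℂ) : ℂ :=
  mixedCumulant P (fun _ : Fin r => Z)

/-- The random variable
`∑_j c¹_{jj} Y_{jj} + ∑_{j ≤ k} c²_{jk} Y_{jk}² + ∑_{ℓ = 3}^L ∑_{j < k} c^ℓ_{jk} Y_{jk}^ℓ`. -/
noncomputable def pairPolynomial {Ω : Type*} {n : ℕ} (L : ℕ) (Y : PairIdx n → Ω → ℝ)
    (c₁ : Fin n → ℂ) (c₂ : PairIdx n → ℂ) (c : ℕ → PairIdx n → ℂ) (ω : Ω) : ℂ :=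
  ∑ j : Fin n, c₁ j * (Y (PairIdx.diag j) ω : ℂ)
    + ∑ p : PairIdx n, c₂ p * (Y p ω : ℂ) ^ 2
    + ∑ ℓ ∈ Finset.Icc 3 L, ∑ p : PairIdx n with p.1.1 < p.1.2, c ℓ p * (Y p ω : ℂ) ^ ℓ

/-- The tuples `(ℓ₁, …, ℓ_r)` with `1 ≤ ℓ_i ≤ L` and `ℓ₁ + ⋯ + ℓ_r` even. -/
def evenTuples (r L : ℕ) : Finset (Fin r → ℕ) :=
  {ℓ ∈ Fintype.piFinset (fun _ : Fin r => Finset.Icc 1 L) | Even (∑ i, ℓ i)}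

theorem evenTuples_nonempty (r : ℕ) {L : ℕ} (hL : 2 ≤ L) : (evenTuples r L).Nonempty :=
  ⟨fun _ => 2, by simp [evenTuples, hL]⟩

/-- The maximum of `C_{ℓ₁} ⋯ C_{ℓ_r}` over all `1 ≤ ℓ₁, …, ℓ_r ≤ L` with even sum. -/
noncomputable def maxCoeffProduct (r : ℕ) {L : ℕ} (hL : 2 ≤ L) (C : ℕ → ℝ) : ℝ :=
  (evenTuples r L).sup' (evenTuples_nonempty r hL) (fun ℓ => ∏ i, C (ℓ i))

/-! By multilinearity, `κ_r(Y)` is a weighted sum of joint cumulants of powers `Y_{x i} ^ l i`, over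
exponents `l` and index maps `x`. By Isserlis' theorem each is a universal polynomial in the
covariances, depending only on `l` (`gaussCumulant`). It vanishes when the total degree is odd,
hence the parity condition in the maximum.

The key point is connectivity. If the covariance matrix is block diagonal for some bipartition of
the factors, the moments factor and the cumulant is zero (`gaussCumulant_eq_zero_of_split`). So
every monomial, read as a graph on the factors with one edge per covariance, is connected
(`exists_crossing_of_mem_support`).

Give a pair weight `n` on the diagonal and `1` off it, absorbing the sizes of the coefficients. The
total weight is at most `2 n ^ 2`, and the weighted sum of the decay around any fixed pair is at
most `10 n`. Summing over `x` along a growing connected set of vertices costs the total weight once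
and `10 n` for each further vertex (`sum_prod_edges_le`): `n ^ 2 * n ^ (r - 1) = n ^ (r + 1)`. -/

theorem finpartition_eq_of_part_eq {ι : Type*} [DecidableEq ι] {s : Finset ι} {π ρ : Finpartition s}
    (h : ∀ i ∈ s, π.part i = ρ.part i) : π = ρ := by
  ext B
  constructor
  · intro hB
    obtain ⟨i, hi⟩ := π.nonempty_of_mem_parts hB
    have his := π.subset hB hi
    rw [← π.part_eq_of_mem hB hi, h i his]
    exact ρ.part_mem.2 his
  · intro hB
    obtain ⟨i, hi⟩ := ρ.nonempty_of_mem_parts hB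
    have his := ρ.subset hB hi
    rw [← ρ.part_eq_of_mem hB hi, ← h i his]
    exact π.part_mem.2 his

/-! ### Cumulants as derivatives at zero of colouring polynomials. -/

section Cumulant

variable {ι R : Type*} [Fintype ι] [DecidableEq ι] [CommRing R]

/-- The cumulant attached to a family of moments `f B`, indexed by the subsets of `ι`. -/
noncomputable def cumulantOf (f : Finset ι → R) : R :=
  ∑ π : Finpartition (Finset.univ : Finset ι),
    (-1 : R) ^ (π.parts.card + 1) * ((π.parts.card - 1)! : R) * ∏ B ∈ π.parts, f B

theorem map_cumulantOf {S : Type*} [CommRing S] (F : R →+* S) (f : Finset ι → R) :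
    F (cumulantOf f) = cumulantOf (fun B => F (f B)) := by
  simp [cumulantOf, map_sum, map_mul, map_pow, map_prod]

/-- The partition of `ι` into the fibres of `g`. -/
def fiberPartition {N : ℕ} (g : ι → Fin N) :
    Finpartition (Finset.univ : Finset ι) :=
  letI : DecidableRel (Setoid.ker g).r := fun i j => decEq (g i) (g j)
  Finpartition.ofSetoid (Setoid.ker g)

theorem mem_part_fiberPartition {N : ℕ} (g : ι → Fin N) {i j : ι} :
    j ∈ (fiberPartition g).part i ↔ g i = g j := by
  let : DecidableRel (Setoid.ker g).r := fun i j => decEq (g i) (g j)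
  exact Finpartition.mem_part_ofSetoid_iff_rel

theorem part_fiberPartition {N : ℕ} (g : ι → Fin N) (i : ι) :
    (fiberPartition g).part i = ({j | g j = g i} : Finset ι) := by
  ext j
  simp [mem_part_fiberPartition, eq_comm]

/-- Used colours correspond to blocks; unused ones contribute `f ∅ = 1`. -/
theorem prod_fiber_eq_prod_parts {f : Finset ι → R} (hf : f ∅ = 1) {N : ℕ} (g : ι → Fin N) :
    ∏ c, f {i | g i = c} = ∏ B ∈ (fiberPartition g).parts, f B := by
  classical
  have himg : (fiberPartition g).parts =
      (Finset.univ.image g).image (fun c => ({i | g i = c} : Finset ι)) := by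
    ext B
    simp only [Finset.mem_image, Finset.mem_univ, true_and, exists_exists_eq_and]
    constructor
    · intro hB
      obtain ⟨i, hi⟩ := (fiberPartition g).nonempty_of_mem_parts hB
      exact ⟨i, by rw [← part_fiberPartition, (fiberPartition g).part_eq_of_mem hB hi]⟩
    · rintro ⟨i, rfl⟩
      rw [← part_fiberPartition]
      exact (fiberPartition g).part_mem.2 (Finset.mem_univ i)
  rw [himg, Finset.prod_image]
  · symm
    apply Finset.prod_subset (Finset.subset_univ _)
    intro c _ hc
    have : ({i | g i = c} : Finset ι) = ∅ := by
      ext i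
      simp only [Finset.mem_filter, Finset.mem_univ, true_and, Finset.notMem_empty, iff_false]
      rintro rfl
      exact hc (Finset.mem_image_of_mem g (Finset.mem_univ i))
    rw [this, hf]
  · intro c hc d _ hcd
    simp only [Finset.coe_image, Finset.coe_univ, Set.image_univ, Set.mem_range] at hc
    obtain ⟨i, rfl⟩ := hc
    simpa using Finset.ext_iff.1 hcd i

/-- A colouring with fibre partition `π` amounts to an injection from the blocks of `π` into the
colours. -/
theorem card_fiberPartition_eq (π : Finpartition (Finset.univ : Finset ι)) (N : ℕ) :
    (Finset.univ.filter fun g : ι → Fin N => fiberPartition g = π).card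
      = N.descFactorial π.parts.card := by
  classical
  have hcard : Fintype.card (π.parts ↪ Fin N) = N.descFactorial π.parts.card := by
    rw [Fintype.card_embedding_eq]; simp
  rw [← hcard, ← Finset.card_univ]
  symm
  have hm : ∀ i, π.part i ∈ π.parts := fun i => π.part_mem.2 (Finset.mem_univ i)
  refine Finset.card_bij (fun e _ i => e ⟨π.part i, hm i⟩) ?_ ?_ ?_
  · intro e _
    simp only [Finset.mem_filter, Finset.mem_univ, true_and]
    apply finpartition_eq_of_part_eq
    intro i _
    ext j
    rw [mem_part_fiberPartition, e.injective.eq_iff, Subtype.mk.injEq,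
      eq_comm, ← π.mem_part_iff_part_eq_part (Finset.mem_univ _) (Finset.mem_univ _)]
  · intro e _ e' _ h
    ext ⟨B, hB⟩
    obtain ⟨i, hi⟩ := π.nonempty_of_mem_parts hB
    have := congrFun h i
    simp only [π.part_eq_of_mem hB hi] at this
    rw [this]
  · intro g hg
    simp only [Finset.mem_filter, Finset.mem_univ, true_and] at hg
    subst hg
    have hne : ∀ B : (fiberPartition g).parts, ∃ i, i ∈ B.1 := fun B =>
      (fiberPartition g).nonempty_of_mem_parts B.2
    choose rep hrep using hne
    refine ⟨⟨fun B => g (rep B), ?_⟩, Finset.mem_univ _, ?_⟩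
    · intro B B' h
      apply Subtype.ext
      rw [← (fiberPartition g).part_eq_of_mem B.2 (hrep B),
        ← (fiberPartition g).part_eq_of_mem B'.2 (hrep B'), part_fiberPartition,
        part_fiberPartition]
      simp only at h
      rw [h]
    · funext i
      have := hrep ⟨(fiberPartition g).part i, hm i⟩
      rw [mem_part_fiberPartition] at this
      exact this.symm

theorem sum_prod_fiber {f : Finset ι → R} (hf : f ∅ = 1) (N : ℕ) :
    ∑ g : ι → Fin N, ∏ c, f {i | g i = c} =
      ∑ π : Finpartition (Finset.univ : Finset ι),
        (N.descFactorial π.parts.card : R) * ∏ B ∈ π.parts, f B := by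
  classical
  rw [← Finset.sum_fiberwise Finset.univ (fun g : ι → Fin N => fiberPartition g)]
  refine Finset.sum_congr rfl fun π _ => ?_
  rw [← card_fiberPartition_eq π N, ← nsmul_eq_mul]
  apply Finset.sum_eq_card_nsmul
  intro g hg
  simp only [Finset.mem_filter, Finset.mem_univ, true_and] at hg
  rw [prod_fiber_eq_prod_parts hf, hg]

open Polynomial in
/-- The polynomial whose value at `N` is `∑ g : ι → Fin N, ∏ c, f (g ⁻¹ c)`. -/
noncomputable def colouringPolynomial (f : Finset ι → R) : R[X] :=
  ∑ π : Finpartition (Finset.univ : Finset ι),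
    C (∏ B ∈ π.parts, f B) * descPochhammer R π.parts.card

theorem eval_colouringPolynomial {f : Finset ι → R} (hf : f ∅ = 1) (N : ℕ) :
    (colouringPolynomial f).eval (N : R) = ∑ g : ι → Fin N, ∏ c, f {i | g i = c} := by
  rw [sum_prod_fiber hf, colouringPolynomial, Polynomial.eval_finsetSum]
  refine Finset.sum_congr rfl fun π _ => ?_
  rw [Polynomial.eval_mul, Polynomial.eval_C, descPochhammer_eval_eq_descFactorial, mul_comm]

theorem card_parts_ne_zero [Nonempty ι] (π : Finpartition (Finset.univ : Finset ι)) :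
    π.parts.card ≠ 0 := by
  rw [Finset.card_ne_zero]
  exact π.parts_nonempty (by simpa using Finset.univ_nonempty.ne_empty)

theorem eval_zero_colouringPolynomial [Nonempty ι] (f : Finset ι → R) :
    (colouringPolynomial f).eval 0 = 0 := by
  rw [colouringPolynomial, Polynomial.eval_finsetSum]
  refine Finset.sum_eq_zero fun π _ => ?_
  rw [Polynomial.eval_mul, descPochhammer_ne_zero_eval_zero R (card_parts_ne_zero π), mul_zero]

theorem eval_neg_one_descPochhammer (n : ℕ) :
    (descPochhammer R n).eval (-1) = (-1) ^ n * (n ! : R) := by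
  induction n with
  | zero => simp
  | succ n ih =>
    rw [descPochhammer_succ_eval, ih, Nat.factorial_succ]
    push_cast
    ring

/-- The falling factorial is `X` times a shifted falling factorial, so its derivative at `0` is the
unshifted one at `-1`. This is the source of the cumulant weights. -/
theorem eval_zero_derivative_descPochhammer {n : ℕ} (hn : n ≠ 0) :
    (Polynomial.derivative (descPochhammer R n)).eval 0 = (-1) ^ (n + 1) * ((n - 1)! : R) := by
  obtain ⟨m, rfl⟩ := Nat.exists_eq_succ_of_ne_zero hn
  rw [Nat.succ_eq_add_one, descPochhammer_succ_left]
  simp [Polynomial.derivative_mul, Polynomial.eval_comp, eval_neg_one_descPochhammer, pow_add]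

theorem eval_zero_derivative_colouringPolynomial [Nonempty ι] (f : Finset ι → R) :
    (Polynomial.derivative (colouringPolynomial f)).eval 0 = cumulantOf f := by
  rw [colouringPolynomial, Polynomial.derivative_sum, Polynomial.eval_finsetSum, cumulantOf]
  refine Finset.sum_congr rfl fun π _ => ?_
  rw [Polynomial.derivative_C_mul, Polynomial.eval_mul, Polynomial.eval_C,
    eval_zero_derivative_descPochhammer (card_parts_ne_zero π), mul_comm]

/-- A colouring of `ι` is a pair of independent colourings of the two sides, and each fibre splits
accordingly. -/
theorem sum_prod_fiber_split (p : ι → Prop) [DecidablePred p] {f : Finset ι → R}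
    {f₁ : Finset {i // p i} → R} {f₂ : Finset {i // ¬ p i} → R}
    (h : ∀ B, f B = f₁ (B.subtype p) * f₂ (B.subtype fun i => ¬ p i)) (N : ℕ) :
    ∑ g : ι → Fin N, ∏ c, f {i | g i = c} =
      (∑ g : {i // p i} → Fin N, ∏ c, f₁ {i | g i = c}) *
        ∑ g : {i // ¬ p i} → Fin N, ∏ c, f₂ {i | g i = c} := by
  classical
  rw [Finset.sum_mul_sum, ← Fintype.sum_prod_type',
    ← (Equiv.piEquivPiSubtypeProd p fun _ => Fin N).sum_comp]
  refine Finset.sum_congr rfl fun g _ => ?_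
  rw [← Finset.prod_mul_distrib]
  refine Finset.prod_congr rfl fun c _ => ?_
  rw [h]
  congr 2 <;> ext i <;> simp [Equiv.piEquivPiSubtypeProd]

/-- The cumulant vanishes if the moments factor along a nontrivial bipartition. -/
theorem cumulantOf_eq_zero_of_split [IsDomain R] [CharZero R] (p : ι → Prop) [DecidablePred p]
    (hp : ∃ i, p i) (hnp : ∃ i, ¬ p i) {f : Finset ι → R}
    {f₁ : Finset {i // p i} → R} {f₂ : Finset {i // ¬ p i} → R}
    (h₁ : f₁ ∅ = 1) (h₂ : f₂ ∅ = 1)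
    (h : ∀ B, f B = f₁ (B.subtype p) * f₂ (B.subtype fun i => ¬ p i)) :
    cumulantOf f = 0 := by
  have : Nonempty ι := ⟨hp.choose⟩
  have : Nonempty {i // p i} := nonempty_subtype.2 hp
  have : Nonempty {i // ¬ p i} := nonempty_subtype.2 hnp
  have hf : f ∅ = 1 := by
    rw [h, show (∅ : Finset ι).subtype p = ∅ from rfl,
      show (∅ : Finset ι).subtype (fun i => ¬ p i) = ∅ from rfl, h₁, h₂, mul_one]
  -- Both sides agree at every natural number, which suffices over a domain of characteristic zero.
  have key : colouringPolynomial f = colouringPolynomial f₁ * colouringPolynomial f₂ := by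
    apply Polynomial.eq_of_infinite_eval_eq
    refine Set.Infinite.mono ?_ (Set.infinite_range_of_injective (Nat.cast_injective (R := R)))
    rintro _ ⟨N, rfl⟩
    simp only [Set.mem_ofPred_eq, Polynomial.eval_mul]
    rw [eval_colouringPolynomial hf, eval_colouringPolynomial h₁, eval_colouringPolynomial h₂,
      sum_prod_fiber_split p h]
  -- Both factors vanish at `0`, so the product rule gives `0`.
  rw [← eval_zero_derivative_colouringPolynomial, key, Polynomial.derivative_mul]
  simp [eval_zero_colouringPolynomial]

end Cumulant

/-! ### Gaussian moments and cumulants as polynomials in the covariances. -/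

section GaussMoment

open MvPolynomial

/-- The factors use disjoint sets of variables, so only one way of splitting the exponent
contributes. -/
theorem coeff_mul_of_mem_supported {ι R : Type*} [CommRing R] (p : ι → Prop) [DecidablePred p]
    {a d : MvPolynomial ι R}
    (ha : a ∈ supported R {i | p i}) (hd : d ∈ supported R {i | ¬ p i}) (l : ι →₀ ℕ) :
    coeff l (a * d) = coeff (l.filter p) a * coeff (l.filter fun i => ¬ p i) d := by
  classical
  rw [mem_supported] at ha hd
  rw [coeff_mul]
  apply Finset.sum_eq_single_of_mem (l.filter p, l.filter fun i => ¬ p i)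
  · rw [Finset.HasAntidiagonal.mem_antidiagonal]
    exact Finsupp.filter_add_filter_not l p
  · rintro ⟨u, v⟩ huv hne
    rw [Finset.HasAntidiagonal.mem_antidiagonal] at huv
    by_contra h
    have hu := left_ne_zero_of_mul h
    have hv := right_ne_zero_of_mul h
    have hu' : ∀ i, ¬ p i → u i = 0 := fun i hi => by
      by_contra hui
      exact hi (ha ((mem_vars_iff_mem_support i).2 ⟨u, mem_support_iff.2 hu, Finsupp.mem_support_iff.2 hui⟩))
    have hv' : ∀ i, p i → v i = 0 := fun i hi => by
      by_contra hvi
      exact hd ((mem_vars_iff_mem_support i).2 ⟨v, mem_support_iff.2 hv, Finsupp.mem_support_iff.2 hvi⟩) hi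
    apply hne
    subst huv
    ext i <;> by_cases hi : p i <;> simp [hi, hu', hv']

variable {ι R : Type*} [Fintype ι] [CommRing R]

/-- The quadratic form `∑ i j, σ i j * X i * X j`. -/
noncomputable def covForm (σ : ι → ι → R) : MvPolynomial ι R :=
  ∑ i, ∑ j, C (σ i j) * (X i * X j)

theorem isHomogeneous_covForm (σ : ι → ι → R) : (covForm σ).IsHomogeneous 2 := by
  refine IsHomogeneous.sum _ _ _ fun i _ => IsHomogeneous.sum _ _ _ fun j _ => ?_
  simpa using (isHomogeneous_C ι (σ i j)).mul ((isHomogeneous_X R i).mul (isHomogeneous_X R j))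

theorem coeff_covForm_pow_eq_zero (σ : ι → ι → R) {m : ℕ} {l : ι →₀ ℕ} (h : l.degree ≠ 2 * m) :
    coeff l (covForm σ ^ m) = 0 :=
  ((isHomogeneous_covForm σ).pow m).coeff_eq_zero h

theorem covForm_add {σ τ : ι → ι → R} : covForm (fun i j => σ i j + τ i j) = covForm σ + covForm τ := by
  simp [covForm, add_mul, Finset.sum_add_distrib]

theorem covForm_mem_supported (p : ι → Prop) {σ : ι → ι → R} (h : ∀ i j, σ i j ≠ 0 → p i ∧ p j) :
    covForm σ ∈ supported R {i | p i} := by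
  refine Subalgebra.sum_mem _ fun i _ => Subalgebra.sum_mem _ fun j _ => ?_
  by_cases hs : σ i j = 0
  · simp [hs]
  · obtain ⟨hi, hj⟩ := h i j hs
    refine Subalgebra.mul_mem _ (Subalgebra.algebraMap_mem _ _) (Subalgebra.mul_mem _ ?_ ?_)
    · exact Algebra.subset_adjoin ⟨i, hi, rfl⟩
    · exact Algebra.subset_adjoin ⟨j, hj, rfl⟩

/-- The part of `σ` inside `p`. -/
def restrictCov (p : ι → Prop) [DecidablePred p] (σ : ι → ι → R) (i j : ι) : R := if p i ∧ p j then σ i j else 0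

theorem covForm_split (p : ι → Prop) [DecidablePred p] {σ : ι → ι → R}
    (hσ : ∀ i j, ¬ (p i ↔ p j) → σ i j = 0) :
    covForm σ = covForm (restrictCov p σ) + covForm (restrictCov (fun i => ¬ p i) σ) := by
  rw [← covForm_add]
  congr 1
  funext i j
  by_cases hi : p i <;> by_cases hj : p j <;> simp [restrictCov, hi, hj, hσ]

theorem coeff_covForm_pow_split (p : ι → Prop) [DecidablePred p] {σ : ι → ι → R}
    (hσ : ∀ i j, ¬ (p i ↔ p j) → σ i j = 0) (m : ℕ) (l : ι →₀ ℕ) :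
    coeff l (covForm σ ^ m) = ∑ k ∈ Finset.range (m + 1),
      coeff (l.filter p) (covForm (restrictCov p σ) ^ k) *
        coeff (l.filter fun i => ¬ p i) (covForm (restrictCov (fun i => ¬ p i) σ) ^ (m - k)) *
        (m.choose k : R) := by
  rw [covForm_split p hσ, add_pow, coeff_sum]
  refine Finset.sum_congr rfl fun k _ => ?_
  rw [← C_eq_coe_nat, mul_comm _ (C _), coeff_C_mul, mul_comm, coeff_mul_of_mem_supported p]
  · refine Subalgebra.pow_mem _ (covForm_mem_supported p fun i j h => ?_) _
    by_contra hn
    exact h (if_neg hn)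
  · refine Subalgebra.pow_mem _ (covForm_mem_supported (fun i => ¬ p i) fun i j h => ?_) _
    by_contra hn
    exact h (if_neg hn)

/-- The exponent has no part outside `p`, so by homogeneity only `k = m` survives in the binomial
expansion. -/
theorem coeff_filter_covForm_pow (p : ι → Prop) [DecidablePred p] {σ : ι → ι → R}
    (hσ : ∀ i j, ¬ (p i ↔ p j) → σ i j = 0) (m : ℕ) (l : ι →₀ ℕ) :
    coeff (l.filter p) (covForm σ ^ m) =
      coeff (l.filter p) (covForm (restrictCov p σ) ^ m) := by
  rw [coeff_covForm_pow_split p hσ, Finset.sum_eq_single_of_mem m (by simp)]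
  · have h1 : (l.filter p).filter p = l.filter p := by
      ext i; by_cases hi : p i <;> simp [hi]
    have h2 : (l.filter p).filter (fun i => ¬ p i) = 0 := by
      ext i; by_cases hi : p i <;> simp [hi]
    simp [h1, h2]
  · intro k hk hkm
    have h2 : (l.filter p).filter (fun i => ¬ p i) = 0 := by
      ext i; by_cases hi : p i <;> simp [hi]
    rw [h2, coeff_covForm_pow_eq_zero (restrictCov (fun i => ¬ p i) σ), mul_zero, zero_mul]
    have := Finset.mem_range.1 hk
    simp only [map_zero]
    omega

variable [Algebra ℝ R]

/-- The mixed moment of order `l` of a centred Gaussian vector with covariance matrix `σ`, as a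
polynomial in the entries of `σ`. -/
noncomputable def gaussMoment (σ : ι → ι → R) (l : ι →₀ ℕ) : R :=
  algebraMap ℝ R ((∏ i, (l i)! : ℕ) / (2 ^ (l.degree / 2) * (l.degree / 2)! : ℕ)) *
    coeff l (covForm σ ^ (l.degree / 2))

theorem gaussMoment_zero (σ : ι → ι → R) : gaussMoment σ 0 = 1 := by
  simp [gaussMoment]

/-- Rounding down in `l.degree / 2` makes the degrees disagree, so the definition needs no parity
case. -/
theorem gaussMoment_eq_zero_of_odd (σ : ι → ι → R) {l : ι →₀ ℕ} (h : Odd l.degree) :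
    gaussMoment σ l = 0 := by
  rw [gaussMoment, coeff_covForm_pow_eq_zero, mul_zero]
  have := Nat.odd_iff.1 h
  omega

theorem map_gaussMoment {S : Type*} [CommRing S] [Algebra ℝ S] (F : R →ₐ[ℝ] S)
    (σ : ι → ι → R) (l : ι →₀ ℕ) :
    F (gaussMoment σ l) = gaussMoment (fun i j => F (σ i j)) l := by
  have hQ : MvPolynomial.map (F : R →+* S) (covForm σ) = covForm fun i j => F (σ i j) := by
    simp [covForm]
  rw [gaussMoment, gaussMoment, map_mul, AlgHom.commutes, ← hQ, ← map_pow, coeff_map]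
  rfl

/-- This is independence of uncorrelated Gaussian blocks, proved algebraically so that it also holds
for formal covariances. Homogeneity leaves one binomial term, whose coefficient turns one factorial
normalisation into the product of two. -/
theorem gaussMoment_split (p : ι → Prop) [DecidablePred p] {σ : ι → ι → R}
    (hσ : ∀ i j, ¬ (p i ↔ p j) → σ i j = 0) (l : ι →₀ ℕ) :
    gaussMoment σ l = gaussMoment σ (l.filter p) * gaussMoment σ (l.filter fun i => ¬ p i) := by
  have hdeg : l.degree = (l.filter p).degree + (l.filter fun i => ¬ p i).degree := by
    rw [← map_add, Finsupp.filter_add_filter_not]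
  have hfact : ∏ i, (l i)! = (∏ i, (l.filter p i)!) * ∏ i, (l.filter (fun i => ¬ p i) i)! := by
    rw [← Finset.prod_mul_distrib]
    refine Finset.prod_congr rfl fun i _ => ?_
    by_cases hi : p i <;> simp [hi]
  have hn : ∀ i j, ¬ (¬ p i ↔ ¬ p j) → σ i j = 0 := fun i j h => hσ i j fun h' => h (not_congr h')
  unfold gaussMoment
  rw [coeff_filter_covForm_pow p hσ, coeff_filter_covForm_pow (fun i => ¬ p i) hn,
    coeff_covForm_pow_split p hσ, hfact, hdeg]
  set a := (l.filter p).degree with ha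
  set b := (l.filter fun i => ¬ p i).degree with hb
  -- If either side has odd degree, both sides of the identity vanish.
  by_cases h : a = 2 * (a / 2) ∧ b = 2 * (b / 2)
  · obtain ⟨h1, h2⟩ := h
    have hab : (a + b) / 2 = a / 2 + b / 2 := by omega
    rw [hab, Finset.sum_eq_single_of_mem (a / 2) (by simp)]
    · rw [Nat.add_sub_cancel_left]
      set x := coeff (l.filter p) (covForm (restrictCov p σ) ^ (a / 2))
      set y := coeff (l.filter fun i => ¬ p i)
        (covForm (restrictCov (fun i => ¬ p i) σ) ^ (b / 2))
      have hc : ((a / 2 + b / 2).choose (a / 2) : R) =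
          algebraMap ℝ R (((a / 2 + b / 2)! : ℝ) / ((a / 2)! * (b / 2)!)) := by
        rw [← Nat.cast_add_choose ℝ, map_natCast]
      rw [hc]
      have hconst : ∀ A B : ℝ, A * B / (2 ^ (a / 2 + b / 2) * (a / 2 + b / 2)!) *
          ((a / 2 + b / 2)! / ((a / 2)! * (b / 2)!)) =
          A / (2 ^ (a / 2) * (a / 2)!) * (B / (2 ^ (b / 2) * (b / 2)!)) := by
        intro A B
        have := Nat.factorial_ne_zero (a / 2 + b / 2)
        rw [pow_add]
        field_simp
      rw [mul_comm (x * y), ← mul_assoc, mul_mul_mul_comm _ x, ← map_mul, ← map_mul]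
      congr 2
      push_cast
      exact hconst _ _
    · intro k hk hka
      rw [coeff_covForm_pow_eq_zero, zero_mul, zero_mul]
      omega
  · rw [Finset.sum_eq_zero, mul_zero]
    · by_cases h1 : a = 2 * (a / 2)
      · rw [coeff_covForm_pow_eq_zero (restrictCov (fun i => ¬ p i) σ), mul_zero, mul_zero]
        omega
      · rw [coeff_covForm_pow_eq_zero (restrictCov p σ), mul_zero, zero_mul]
        omega
    · intro k hk
      by_cases h1 : a = 2 * k
      · rw [coeff_covForm_pow_eq_zero (restrictCov (fun i => ¬ p i) σ), mul_zero, zero_mul]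
        have := Finset.mem_range.1 hk
        omega
      · rw [coeff_covForm_pow_eq_zero (restrictCov p σ), zero_mul, zero_mul]
        omega

section CumulantPolynomial

variable [DecidableEq ι]

/-- The joint cumulant of the powers `X i ^ l i` of a centred Gaussian vector with covariance
matrix `σ`, as a polynomial in the entries of `σ`. -/
noncomputable def gaussCumulant (σ : ι → ι → R) (l : ι →₀ ℕ) : R :=
  cumulantOf fun B : Finset ι => gaussMoment σ (l.filter (· ∈ B))

theorem map_gaussCumulant {S : Type*} [CommRing S] [Algebra ℝ S] (F : R →ₐ[ℝ] S)
    (σ : ι → ι → R) (l : ι →₀ ℕ) :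
    F (gaussCumulant σ l) = gaussCumulant (fun i j => F (σ i j)) l := by
  have := map_cumulantOf (F : R →+* S) fun B : Finset ι => gaussMoment σ (l.filter (· ∈ B))
  simpa [gaussCumulant, map_gaussMoment] using this

/-- In every partition some block has odd degree, and its moment vanishes. -/
theorem gaussCumulant_eq_zero_of_odd (σ : ι → ι → R) {l : ι →₀ ℕ} (h : Odd l.degree) :
    gaussCumulant σ l = 0 := by
  refine Finset.sum_eq_zero fun π _ => ?_
  have hB : ∃ B ∈ π.parts, Odd (l.filter (· ∈ B)).degree := by
    by_contra! hcon
    simp only [Nat.not_odd_iff_even] at hcon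
    refine Nat.not_even_iff_odd.2 h ?_
    have : l.degree = ∑ B ∈ π.parts, (l.filter (· ∈ B)).degree := by
      simp only [Finsupp.degree_eq_sum, Finsupp.filter_apply]
      rw [Finset.sum_comm]
      refine Finset.sum_congr rfl fun i _ => ?_
      rw [Finset.sum_eq_single_of_mem (π.part i) (π.part_mem.2 (Finset.mem_univ i))]
      · simp
      · intro B hB hne
        rw [if_neg]
        intro hi
        exact hne (π.part_eq_of_mem hB hi).symm
    rw [this]
    exact Finset.even_sum _ hcon
  obtain ⟨B, hB, hodd⟩ := hB
  rw [Finset.prod_eq_zero hB (gaussMoment_eq_zero_of_odd σ hodd), mul_zero]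

theorem gaussCumulant_eq_zero_of_split [IsDomain R] [CharZero R] (p : ι → Prop) [DecidablePred p]
    (hp : ∃ i, p i) (hnp : ∃ i, ¬ p i) {σ : ι → ι → R}
    (hσ : ∀ i j, ¬ (p i ↔ p j) → σ i j = 0) (l : ι →₀ ℕ) :
    gaussCumulant σ l = 0 := by
  refine cumulantOf_eq_zero_of_split p hp hnp
    (f₁ := fun B => gaussMoment σ (l.filter (· ∈ B.map (Function.Embedding.subtype p))))
    (f₂ := fun B => gaussMoment σ (l.filter (· ∈ B.map (Function.Embedding.subtype _))))
    ?_ ?_ fun B => ?_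
  · rw [← gaussMoment_zero σ]
    congr 1
    ext i
    simp
  · rw [← gaussMoment_zero σ]
    congr 1
    ext i
    simp
  · rw [gaussMoment_split p hσ]
    congr 2 <;> ext i <;> by_cases hi : p i <;> simp [Finsupp.filter_apply, hi]

/-- Deleting the variables outside `q` does not change the coefficients of the monomials in the
variables of `q`. -/
theorem coeff_delete_crossing {κ : Type*} (q : κ → Prop) [DecidablePred q]
    (f : MvPolynomial κ ℝ) {d : κ →₀ ℕ} (hd : ∀ e ∈ d.support, q e) :
    coeff d (bind₁ (fun e => if q e then X e else 0) f) = coeff d f := by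
  classical
  induction f using MvPolynomial.induction_on' with
  | add f g hf hg => rw [map_add, coeff_add, coeff_add, hf, hg]
  | monomial u a =>
    rw [bind₁_monomial]
    by_cases hu : ∀ e ∈ u.support, q e
    · rw [monomial_eq, Finsupp.prod]
      congr 2
      exact Finset.prod_congr rfl fun e he => by rw [if_pos (hu e he)]
    · push Not at hu
      obtain ⟨e, he, hq⟩ := hu
      rw [Finset.prod_eq_zero he, mul_zero, coeff_zero, coeff_monomial, if_neg]
      · rintro rfl
        exact hq (hd e he)
      · rw [if_neg hq, zero_pow (Finsupp.mem_support_iff.1 he)]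

/-- Setting all crossing variables to zero makes the covariance block diagonal and kills the
cumulant, yet keeps the coefficient of any monomial without crossing variables. Letting `p` vary,
the graph `d.support` is connected. -/
theorem exists_crossing_of_mem_support {l : ι →₀ ℕ} {d : ι × ι →₀ ℕ}
    (hd : d ∈ (gaussCumulant (fun i j => (X (i, j) : MvPolynomial (ι × ι) ℝ)) l).support)
    (p : ι → Prop) (hp : ∃ i, p i) (hnp : ∃ i, ¬ p i) :
    ∃ i j, p i ∧ ¬ p j ∧ ((i, j) ∈ d.support ∨ (j, i) ∈ d.support) := by
  classical
  by_contra! hcon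
  have hcr : ∀ e ∈ d.support, (p e.1 ↔ p e.2) := by
    rintro ⟨i, j⟩ he
    by_cases hi : p i <;> by_cases hj : p j <;> simp only [hi, hj, iff_self, iff_false, not_true]
    · exact (hcon i j hi hj).1 he
    · exact ((hcon j i hj hi).2 he).elim
  rw [mem_support_iff, ← coeff_delete_crossing (fun e : ι × ι => (p e.1 ↔ p e.2)) _ hcr] at hd
  apply hd
  rw [map_gaussCumulant ((bind₁ fun e : ι × ι => if (p e.1 ↔ p e.2) then X e else 0)),
    gaussCumulant_eq_zero_of_split p hp hnp, coeff_zero]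
  intro i j hij
  simp [hij]

end CumulantPolynomial

end GaussMoment

/-! ### Weighted sums over connected graphs. -/

section TreeBound

variable {ι I : Type*} [Fintype ι] [DecidableEq ι] [Fintype I]

theorem sum_le_sum_of_update_le [Nonempty I] (v : ι) {f g : (ι → I) → ℝ}
    (h : ∀ x, ∑ y, f (Function.update x v y) ≤ ∑ y, g (Function.update x v y)) :
    ∑ x, f x ≤ ∑ x, g x := by
  have i₀ : I := Classical.arbitrary I
  have key : ∀ f : (ι → I) → ℝ, ∑ x, f x = ∑ z : {j // j ≠ v} → I,
      ∑ y, f (Function.update ((Equiv.funSplitAt v I).symm (i₀, z)) v y) := by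
    intro f
    rw [← (Equiv.funSplitAt v I).symm.sum_comp, Fintype.sum_prod_type, Finset.sum_comm]
    refine Finset.sum_congr rfl fun z _ => Finset.sum_congr rfl fun y _ => ?_
    congr 1
    ext j
    by_cases hj : j = v
    · subst hj; simp [Equiv.funSplitAt, Equiv.piSplitAt]
    · simp [Equiv.funSplitAt, Equiv.piSplitAt, hj]
  rw [key f, key g]
  exact Finset.sum_le_sum fun z _ => h _

/-- The edges of `E` inside `T`. -/
def edgesInside (E : Finset (ι × ι)) (T : Finset ι) : Finset (ι × ι) :=
  E.filter fun e => e.1 ∈ T ∧ e.2 ∈ T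

variable {w : I → ℝ} {β : I → I → ℝ} {c : ℝ}

/-- With `v` outside `T` its coordinate is free and contributes the total weight; one edge to `u`
replaces that factor by at most `c`. The other new edges are bounded by `1`. Keeping all coordinates
in the sum avoids changing the index type as `T` grows. -/
theorem sum_prod_edgesInside_insert_le [Nonempty I] (hw : ∀ a, 0 ≤ w a) (hβ₀ : ∀ a b, 0 ≤ β a b)
    (hβ₁ : ∀ a b, β a b ≤ 1) (hβs : ∀ a b, β a b = β b a)
    (hc : ∀ a, ∑ b, w b * β a b ≤ c) (E : Finset (ι × ι)) (T : Finset ι)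
    {u v : ι} (hu : u ∈ T) (hv : v ∉ T) (huv : (u, v) ∈ E ∨ (v, u) ∈ E) :
    (∑ a, w a) * ∑ x : ι → I, (∏ i, w (x i)) * ∏ e ∈ edgesInside E (insert v T), β (x e.1) (x e.2)
      ≤ c * ∑ x : ι → I, (∏ i, w (x i)) * ∏ e ∈ edgesInside E T, β (x e.1) (x e.2) := by
  have hne : u ≠ v := fun h => hv (h ▸ hu)
  have hedge : ∀ x : ι → I, ∏ e ∈ edgesInside E (insert v T), β (x e.1) (x e.2) ≤
      β (x u) (x v) * ∏ e ∈ edgesInside E T, β (x e.1) (x e.2) := by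
    intro x
    obtain ⟨e₀, he₀, hval, hT⟩ : ∃ e₀ ∈ edgesInside E (insert v T),
        β (x e₀.1) (x e₀.2) = β (x u) (x v) ∧ e₀ ∉ edgesInside E T := by
      rcases huv with h | h
      · exact ⟨(u, v), by simp [edgesInside, h, hu], rfl, by simp [edgesInside, hv]⟩
      · exact ⟨(v, u), by simp [edgesInside, h, hu], hβs _ _, by simp [edgesInside, hv]⟩
    rw [← hval, ← Finset.prod_insert (f := fun e => β (x e.1) (x e.2)) hT]
    have hsub : insert e₀ (edgesInside E T) ⊆ edgesInside E (insert v T) := by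
      intro e he
      rcases Finset.mem_insert.1 he with rfl | he
      · exact he₀
      · simp only [edgesInside, Finset.mem_filter] at he ⊢
        exact ⟨he.1, Finset.mem_insert_of_mem he.2.1, Finset.mem_insert_of_mem he.2.2⟩
    rw [← Finset.prod_sdiff hsub]
    exact mul_le_of_le_one_left (Finset.prod_nonneg fun e _ => hβ₀ _ _)
      (Finset.prod_le_one (fun e _ => hβ₀ _ _) fun e _ => hβ₁ _ _)
  rw [Finset.mul_sum, Finset.mul_sum]
  apply sum_le_sum_of_update_le v
  intro x
  set H := (∏ i ∈ Finset.univ.erase v, w (x i)) * ∏ e ∈ edgesInside E T, β (x e.1) (x e.2) with hH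
  have hH₀ : 0 ≤ H := mul_nonneg (Finset.prod_nonneg fun i _ => hw _)
    (Finset.prod_nonneg fun e _ => hβ₀ _ _)
  have hwprod : ∀ y, ∏ i, w (Function.update x v y i) =
      w y * ∏ i ∈ Finset.univ.erase v, w (x i) := by
    intro y
    rw [← Finset.mul_prod_erase _ _ (Finset.mem_univ v), Function.update_self]
    congr 1
    refine Finset.prod_congr rfl fun i hi => ?_
    rw [Function.update_of_ne (Finset.ne_of_mem_erase hi)]
  have hEprod : ∀ y, ∏ e ∈ edgesInside E T,
      β (Function.update x v y e.1) (Function.update x v y e.2) =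
        ∏ e ∈ edgesInside E T, β (x e.1) (x e.2) := by
    intro y
    refine Finset.prod_congr rfl fun e he => ?_
    simp only [edgesInside, Finset.mem_filter] at he
    rw [Function.update_of_ne (fun h : e.1 = v => hv (h ▸ he.2.1)),
      Function.update_of_ne (fun h : e.2 = v => hv (h ▸ he.2.2))]
  have hW : 0 ≤ ∑ a, w a := Finset.sum_nonneg fun a _ => hw a
  calc _ ≤ ∑ y, (∑ a, w a) * (H * (w y * β (x u) y)) := by
        refine Finset.sum_le_sum fun y _ => mul_le_mul_of_nonneg_left ?_ hW
        refine (mul_le_mul_of_nonneg_left (hedge _)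
          (Finset.prod_nonneg fun i _ => hw _)).trans_eq ?_
        rw [hwprod, hEprod, Function.update_self, Function.update_of_ne hne, hH]
        ring
    _ = (∑ a, w a) * (H * ∑ y, w y * β (x u) y) := by simp only [Finset.mul_sum]
    _ ≤ (∑ a, w a) * (H * c) := by gcongr; exact hc _
    _ = ∑ y, c * (w y * H) := by rw [← Finset.mul_sum, ← Finset.sum_mul]; ring
    _ = _ := by
        refine Finset.sum_congr rfl fun y _ => ?_
        rw [hwprod, hEprod, hH]
        ring

/-- The weighted sum of the products of `β` over the edges of a connected graph. -/
theorem sum_prod_edges_le [Nonempty ι] (hw : ∀ a, 0 ≤ w a) (hW : 0 < ∑ a, w a)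
    (hβ₀ : ∀ a b, 0 ≤ β a b) (hβ₁ : ∀ a b, β a b ≤ 1) (hβs : ∀ a b, β a b = β b a)
    (hc : ∀ a, ∑ b, w b * β a b ≤ c) (hc₀ : 0 ≤ c) (E : Finset (ι × ι))
    (hE : ∀ T : Finset ι, T.Nonempty → T ≠ Finset.univ →
      ∃ u ∈ T, ∃ v ∉ T, (u, v) ∈ E ∨ (v, u) ∈ E) :
    ∑ x : ι → I, (∏ i, w (x i)) * ∏ e ∈ E, β (x e.1) (x e.2)
      ≤ (∑ a, w a) * c ^ (Fintype.card ι - 1) := by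
  have : Nonempty I := by
    by_contra h
    rw [not_nonempty_iff] at h
    simp at hW
  -- Grow `T` from one vertex, each time along an edge leaving it; this traces a spanning tree
  -- without naming one.
  have key : ∀ k < Fintype.card ι, ∃ T : Finset ι, T.card = k + 1 ∧
      (∑ a, w a) ^ k * ∑ x : ι → I, (∏ i, w (x i)) * ∏ e ∈ edgesInside E T, β (x e.1) (x e.2)
        ≤ c ^ k * (∑ a, w a) ^ Fintype.card ι := by
    intro k
    induction k with
    | zero =>
      intro _
      refine ⟨{Classical.arbitrary ι}, by simp, ?_⟩
      rw [pow_zero, one_mul, pow_zero, one_mul]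
      calc _ ≤ ∑ x : ι → I, ∏ i, w (x i) := by
            refine Finset.sum_le_sum fun x _ => mul_le_of_le_one_right
              (Finset.prod_nonneg fun i _ => hw _)
              (Finset.prod_le_one (fun e _ => hβ₀ _ _) fun e _ => hβ₁ _ _)
        _ = (∑ a, w a) ^ Fintype.card ι := by
            rw [← Fintype.piFinset_univ, ← Finset.prod_univ_sum (fun _ : ι => Finset.univ)
              fun _ a => w a]
            simp
    | succ k ih =>
      intro hk
      obtain ⟨T, hT, hle⟩ := ih (by omega)
      obtain ⟨u, hu, v, hv, huv⟩ := hE T (Finset.card_pos.1 (by omega)) (by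
        rintro rfl
        rw [Finset.card_univ] at hT
        omega)
      refine ⟨insert v T, by rw [Finset.card_insert_of_notMem hv, hT], ?_⟩
      calc _ = (∑ a, w a) ^ k * ((∑ a, w a) * ∑ x : ι → I, (∏ i, w (x i)) *
            ∏ e ∈ edgesInside E (insert v T), β (x e.1) (x e.2)) := by ring
        _ ≤ (∑ a, w a) ^ k * (c * ∑ x : ι → I, (∏ i, w (x i)) *
            ∏ e ∈ edgesInside E T, β (x e.1) (x e.2)) := by
            refine mul_le_mul_of_nonneg_left ?_ (pow_nonneg hW.le _)
            exact sum_prod_edgesInside_insert_le hw hβ₀ hβ₁ hβs hc E T hu hv huv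
        _ = c * ((∑ a, w a) ^ k * ∑ x : ι → I, (∏ i, w (x i)) *
            ∏ e ∈ edgesInside E T, β (x e.1) (x e.2)) := by ring
        _ ≤ c * (c ^ k * (∑ a, w a) ^ Fintype.card ι) := mul_le_mul_of_nonneg_left hle hc₀
        _ = _ := by ring
  have hcard : 0 < Fintype.card ι := Fintype.card_pos
  obtain ⟨T, hT, hle⟩ := key (Fintype.card ι - 1) (by omega)
  have hTu : T = Finset.univ := by
    rw [← Finset.card_eq_iff_eq_univ]
    omega
  have hEu : edgesInside E T = E := by simp [edgesInside, hTu]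
  rw [hEu] at hle
  refine le_of_mul_le_mul_left ?_ (pow_pos hW (Fintype.card ι - 1))
  refine hle.trans_eq ?_
  rw [mul_comm (_ ^ _) (_ * _), mul_right_comm, ← pow_succ', Nat.sub_add_cancel hcard, mul_comm]

end TreeBound

/-! ### Summing Gaussian cumulants over index maps. -/

section GaussCumulantBound

open MvPolynomial

variable {ι I : Type*} [Fintype ι] [DecidableEq ι] [Fintype I]

/-- The sum of the absolute values of the coefficients of the cumulant polynomial, each weighted with
a power of `A`. -/
noncomputable def gaussCumulantConst (l : ι →₀ ℕ) (A : ℝ) : ℝ :=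
  ∑ d ∈ (gaussCumulant (fun i j => (X (i, j) : MvPolynomial (ι × ι) ℝ)) l).support,
    |coeff d (gaussCumulant (fun i j => (X (i, j) : MvPolynomial (ι × ι) ℝ)) l)| * A ^ d.degree

theorem gaussCumulantConst_nonneg (l : ι →₀ ℕ) {A : ℝ} (hA : 0 ≤ A) :
    0 ≤ gaussCumulantConst l A :=
  Finset.sum_nonneg fun _ _ => by positivity

theorem abs_gaussCumulant_le {A : ℝ} (hA : 0 ≤ A) {σ b : ι → ι → ℝ} (hb₀ : ∀ i j, 0 ≤ b i j)
    (hb₁ : ∀ i j, b i j ≤ 1) (hσ : ∀ i j, |σ i j| ≤ A * b i j) (l : ι →₀ ℕ) :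
    |gaussCumulant σ l| ≤
      ∑ d ∈ (gaussCumulant (fun i j => (X (i, j) : MvPolynomial (ι × ι) ℝ)) l).support,
        |coeff d (gaussCumulant (fun i j => (X (i, j) : MvPolynomial (ι × ι) ℝ)) l)| *
          A ^ d.degree * ∏ e ∈ d.support, b e.1 e.2 := by
  have h : gaussCumulant σ l = aeval (fun e : ι × ι => σ e.1 e.2)
      (gaussCumulant (fun i j => (X (i, j) : MvPolynomial (ι × ι) ℝ)) l) := by
    rw [map_gaussCumulant]
    simp
  rw [h, aeval_eq_eval, eval_eq]
  refine (Finset.abs_sum_le_sum_abs _ _).trans (Finset.sum_le_sum fun d _ => ?_)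
  rw [abs_mul, mul_assoc, Finset.abs_prod, Finsupp.degree_apply, ← Finset.prod_pow_eq_pow_sum,
    ← Finset.prod_mul_distrib]
  refine mul_le_mul_of_nonneg_left ?_ (abs_nonneg _)
  refine Finset.prod_le_prod (fun e _ => abs_nonneg _) fun e he => ?_
  rw [abs_pow]
  refine (pow_le_pow_left₀ (abs_nonneg _) (hσ _ _) _).trans ?_
  rw [mul_pow]
  refine mul_le_mul_of_nonneg_left ?_ (pow_nonneg hA _)
  -- Edge multiplicities are dropped: only the simple graph matters for the decay.
  exact pow_le_of_le_one (hb₀ _ _) (hb₁ _ _) (Finsupp.mem_support_iff.1 he)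

theorem sum_abs_gaussCumulant_le [Nonempty ι] {A c : ℝ} (hA : 0 ≤ A) {w : I → ℝ} {β s : I → I → ℝ}
    (hw : ∀ a, 0 ≤ w a) (hW : 0 < ∑ a, w a)
    (hβ₀ : ∀ a b, 0 ≤ β a b) (hβ₁ : ∀ a b, β a b ≤ 1) (hβs : ∀ a b, β a b = β b a)
    (hc : ∀ a, ∑ b, w b * β a b ≤ c) (hc₀ : 0 ≤ c) (hs : ∀ a b, |s a b| ≤ A * β a b)
    (l : ι →₀ ℕ) :
    ∑ x : ι → I, (∏ i, w (x i)) * |gaussCumulant (fun i j => s (x i) (x j)) l| ≤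
      gaussCumulantConst l A * ((∑ a, w a) * c ^ (Fintype.card ι - 1)) := by
  calc _ ≤ ∑ x : ι → I, (∏ i, w (x i)) *
        ∑ d ∈ (gaussCumulant (fun i j => (X (i, j) : MvPolynomial (ι × ι) ℝ)) l).support,
        |coeff d (gaussCumulant (fun i j => (X (i, j) : MvPolynomial (ι × ι) ℝ)) l)| *
          A ^ d.degree * ∏ e ∈ d.support, β (x e.1) (x e.2) := by
        refine Finset.sum_le_sum fun x _ => mul_le_mul_of_nonneg_left ?_
          (Finset.prod_nonneg fun i _ => hw _)
        exact abs_gaussCumulant_le hA (b := fun i j => β (x i) (x j)) (fun _ _ => hβ₀ _ _)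
          (fun _ _ => hβ₁ _ _) (fun _ _ => hs _ _) l
    _ = ∑ d ∈ (gaussCumulant (fun i j => (X (i, j) : MvPolynomial (ι × ι) ℝ)) l).support,
        |coeff d (gaussCumulant (fun i j => (X (i, j) : MvPolynomial (ι × ι) ℝ)) l)| *
          A ^ d.degree * ∑ x : ι → I, (∏ i, w (x i)) * ∏ e ∈ d.support, β (x e.1) (x e.2) := by
        simp only [Finset.mul_sum]
        rw [Finset.sum_comm]
        refine Finset.sum_congr rfl fun d _ => Finset.sum_congr rfl fun x _ => ?_
        ring
    _ ≤ _ := by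
        rw [gaussCumulantConst, Finset.sum_mul]
        refine Finset.sum_le_sum fun d hd => mul_le_mul_of_nonneg_left ?_ (by positivity)
        refine sum_prod_edges_le hw hW hβ₀ hβ₁ hβs hc hc₀ d.support fun T hT hTu => ?_
        obtain ⟨i, j, hi, hj, hij⟩ := exists_crossing_of_mem_support hd (· ∈ T) hT (by
          by_contra! h
          exact hTu (Finset.eq_univ_iff_forall.2 h))
        exact ⟨i, hi, j, hj, hij⟩

end GaussCumulantBound

/-! ### Isserlis' theorem from one-dimensional Gaussian moments. -/

section GaussianMoments

/-- Repeated differentiation of `f' = v t f`; at `t = 0` it becomes the moment recursion. -/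
theorem iteratedDeriv_exp_sq (v : ℝ) (n : ℕ) (t : ℝ) :
    iteratedDeriv (n + 2) (fun s => Real.exp (v * s ^ 2 / 2)) t =
      v * t * iteratedDeriv (n + 1) (fun s => Real.exp (v * s ^ 2 / 2)) t +
        v * (n + 1) * iteratedDeriv n (fun s => Real.exp (v * s ^ 2 / 2)) t := by
  set f : ℝ → ℝ := fun s => Real.exp (v * s ^ 2 / 2) with hf
  have hsmooth : ContDiff ℝ ⊤ f := by
    rw [hf]
    fun_prop
  have hd : ∀ n t, HasDerivAt (iteratedDeriv n f) (iteratedDeriv (n + 1) f t) t := by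
    intro n t
    rw [iteratedDeriv_succ]
    exact (hsmooth.differentiable_iteratedDeriv n (by exact_mod_cast WithTop.coe_lt_top _)
      t).hasDerivAt
  have h1 : iteratedDeriv 1 f = fun t => v * t * f t := by
    funext t
    rw [iteratedDeriv_one]
    have : HasDerivAt (fun s : ℝ => v * s ^ 2 / 2) (v * t) t := by
      refine (((hasDerivAt_id t).pow 2).const_mul v |>.div_const 2).congr_deriv ?_
      simp
      ring
    rw [this.exp.deriv]
    ring
  induction n generalizing t with
  | zero =>
    have h2 := hd 1 t
    rw [h1] at h2
    have h3 : HasDerivAt (fun t => v * t * f t) (v * f t + v * t * iteratedDeriv 1 f t) t := by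
      have h0 := hd 0 t
      rw [iteratedDeriv_zero] at h0
      simpa using ((hasDerivAt_id t).const_mul v).fun_mul h0
    have := h2.unique h3
    simp only [Nat.reduceAdd, zero_add, iteratedDeriv_zero, Nat.cast_zero, mul_one] at this ⊢
    rw [this]
    ring
  | succ n ih =>
    have h2 := hd (n + 2) t
    rw [funext ih] at h2
    have h3 : HasDerivAt (fun t => v * t * iteratedDeriv (n + 1) f t +
        v * (n + 1) * iteratedDeriv n f t)
        (v * iteratedDeriv (n + 1) f t + v * t * iteratedDeriv (n + 2) f t +
          v * (n + 1) * iteratedDeriv (n + 1) f t) t := by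
      have h4 := (((hasDerivAt_id t).const_mul v).fun_mul (hd (n + 1) t)).fun_add
        ((hd n t).const_mul (v * (n + 1)))
      simpa using h4
    rw [show n + 1 + 2 = n + 2 + 1 by ring, h2.unique h3]
    push_cast
    ring

variable {Ω : Type*} [MeasurableSpace Ω] {P : Measure Ω}

theorem integral_pow_succ_succ_of_gaussian [IsProbabilityMeasure P] {L : Ω → ℝ}
    (hL : HasGaussianLaw L P) (h0 : P[L] = 0) (n : ℕ) :
    ∫ ω, L ω ^ (n + 2) ∂P = (n + 1) * Var[L; P] * ∫ ω, L ω ^ n ∂P := by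
  have hmap := hL.map_eq_gaussianReal
  rw [h0] at hmap
  have hset : integrableExpSet L P = Set.univ := by
    ext t
    simp only [integrableExpSet, Set.mem_ofPred_eq, Set.mem_univ, iff_true]
    have := integrable_exp_mul_gaussianReal (μ := 0) (v := Var[L; P].toNNReal) t
    rw [← hmap] at this
    exact this.comp_aemeasurable hL.aemeasurable
  have hv : ((Var[L; P].toNNReal : NNReal) : ℝ) = Var[L; P] :=
    Real.coe_toNNReal _ (variance_nonneg _ _)
  have hmgf : mgf L P = fun s => Real.exp (Var[L; P] * s ^ 2 / 2) := by
    funext t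
    rw [mgf_gaussianReal hmap, hv, zero_mul, zero_add]
  have hmom : ∀ k, ∫ ω, L ω ^ k ∂P =
      iteratedDeriv k (fun s => Real.exp (Var[L; P] * s ^ 2 / 2)) 0 := by
    intro k
    rw [← hmgf, iteratedDeriv_mgf_zero (by simp [hset])]
    rfl
  rw [hmom, hmom, iteratedDeriv_exp_sq]
  ring

theorem integral_pow_two_mul_of_gaussian [IsProbabilityMeasure P] {L : Ω → ℝ}
    (hL : HasGaussianLaw L P) (h0 : P[L] = 0) (m : ℕ) :
    ∫ ω, L ω ^ (2 * m) ∂P = (2 * m)! / (2 ^ m * m !) * Var[L; P] ^ m := by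
  induction m with
  | zero => simp
  | succ m ih =>
    rw [Nat.mul_succ, integral_pow_succ_succ_of_gaussian hL h0, ih]
    rw [Nat.factorial_succ (2 * m + 1), Nat.factorial_succ (2 * m), Nat.factorial_succ m]
    push_cast
    field_simp
    ring

theorem integral_pow_odd_of_gaussian [IsProbabilityMeasure P] {L : Ω → ℝ}
    (hL : HasGaussianLaw L P) (h0 : P[L] = 0) (m : ℕ) :
    ∫ ω, L ω ^ (2 * m + 1) ∂P = 0 := by
  induction m with
  | zero => simpa using h0
  | succ m ih =>
    rw [show 2 * (m + 1) + 1 = 2 * m + 1 + 2 by ring, integral_pow_succ_succ_of_gaussian hL h0, ih,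
      mul_zero]

variable {ι : Type*} [Fintype ι] {X : ι → Ω → ℝ}

/-- The monomial is dominated by a power of the sup norm of the vector, which has all moments. -/
theorem integrable_prod_pow_of_gaussian (hX : HasGaussianLaw (fun ω i => X i ω) P) (l : ι → ℕ) :
    Integrable (fun ω => ∏ i, X i ω ^ l i) P := by
  have := hX.isProbabilityMeasure
  have hcont : Continuous fun x : ι → ℝ => ∏ i, x i ^ l i := by fun_prop
  have hm : MemLp (fun ω i => X i ω) (∑ i, l i : ℕ) P := hX.memLp (ENNReal.natCast_ne_top _)
  refine (hm.integrable_norm_pow').mono'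
    (hcont.comp_aestronglyMeasurable hX.aemeasurable.aestronglyMeasurable)
    (Filter.Eventually.of_forall fun ω => ?_)
  rw [norm_prod, ← Finset.prod_pow_eq_pow_sum]
  refine Finset.prod_le_prod (fun i _ => norm_nonneg _) fun i _ => ?_
  rw [norm_pow]
  exact pow_le_pow_left₀ (norm_nonneg _) (norm_le_pi_norm (fun i => X i ω) i) _

theorem hasGaussianLaw_linearCombination (hX : HasGaussianLaw (fun ω i => X i ω) P) (t : ι → ℝ) :
    HasGaussianLaw (fun ω => ∑ i, t i * X i ω) P := by
  have := hX.map_fun (∑ i, t i • (ContinuousLinearMap.proj (R := ℝ) i : (ι → ℝ) →L[ℝ] ℝ))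
  simpa using this

open MvPolynomial in
/-- **Isserlis' theorem**: the mixed moments of a centred Gaussian vector. -/
theorem integral_prod_pow_eq_gaussMoment (hX : HasGaussianLaw (fun ω i => X i ω) P)
    (h0 : ∀ i, ∫ ω, X i ω ∂P = 0) (l : ι →₀ ℕ) :
    ∫ ω, ∏ i, X i ω ^ l i ∂P = gaussMoment (fun i j => cov[X i, X j; P]) l := by
  classical
  have := hX.isProbabilityMeasure
  set k := l.degree with hk
  set σ : ι → ι → ℝ := fun i j => cov[X i, X j; P] with hσ
  have hmem : ∀ i, MemLp (X i) 2 P := fun i => (hX.eval i).memLp_two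
  have hmean : ∀ t : ι → ℝ, P[fun ω => ∑ i, t i * X i ω] = 0 := by
    intro t
    rw [integral_finsetSum _ fun i _ => ((hmem i).integrable (by norm_num)).const_mul _]
    simp [integral_const_mul, h0]
  have hvar : ∀ t : ι → ℝ, Var[fun ω => ∑ i, t i * X i ω; P] = eval t (covForm σ) := by
    intro t
    rw [← covariance_self (hasGaussianLaw_linearCombination hX t).aemeasurable,
      covariance_fun_sum_fun_sum (fun i => (hmem i).const_mul _) fun i => (hmem i).const_mul _]
    simp only [covariance_const_mul_left, covariance_const_mul_right, covForm, map_sum, map_mul,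
      eval_C, eval_X, hσ]
    exact Finset.sum_congr rfl fun i _ => Finset.sum_congr rfl fun j _ => by ring
  have hexp : ∀ t : ι → ℝ, ∫ ω, (∑ i, t i * X i ω) ^ k ∂P =
      ∑ u ∈ Finset.piAntidiag Finset.univ k, (Nat.multinomial Finset.univ u : ℝ) *
        (∫ ω, ∏ i, X i ω ^ u i ∂P) * ∏ i, t i ^ u i := by
    intro t
    simp_rw [Finset.sum_pow_eq_sum_piAntidiag, mul_pow, Finset.prod_mul_distrib]
    rw [integral_finsetSum]
    · refine Finset.sum_congr rfl fun u _ => ?_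
      rw [integral_const_mul, integral_const_mul]
      ring
    · intro u _
      exact ((integrable_prod_pow_of_gaussian hX u).const_mul _).const_mul _
  set c : ℝ := if Even k then k ! / (2 ^ (k / 2) * (k / 2)!) else 0 with hc
  have hmom : ∀ t : ι → ℝ, ∫ ω, (∑ i, t i * X i ω) ^ k ∂P = c * eval t (covForm σ) ^ (k / 2) := by
    intro t
    have hL := hasGaussianLaw_linearCombination hX t
    rcases Nat.even_or_odd' k with ⟨m, hm | hm⟩
    · have hev : Even k := ⟨m, by omega⟩
      have hm2 : k / 2 = m := by omega
      rw [hc, if_pos hev, hm2, hm, integral_pow_two_mul_of_gaussian hL (hmean t), hvar]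
    · have hodd : ¬ Even k := Nat.not_even_iff_odd.2 ⟨m, hm⟩
      rw [hc, if_neg hodd, hm, integral_pow_odd_of_gaussian hL (hmean t), zero_mul]
  -- The `k`-th moment of `∑ i, t i * X i`, computed by the multinomial theorem and by its
  -- one-dimensional law, gives two polynomials in `t`. Comparing coefficients at `l` isolates the
  -- mixed moment.
  have hpoly : (∑ u ∈ Finset.piAntidiag Finset.univ k,
      monomial (Finsupp.equivFunOnFinite.symm u) ((Nat.multinomial Finset.univ u : ℝ) *
        (∫ ω, ∏ i, X i ω ^ u i ∂P))) = C c * covForm σ ^ (k / 2) := by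
    apply MvPolynomial.funext
    intro t
    rw [map_sum, map_mul, map_pow, eval_C, ← hmom, hexp]
    refine Finset.sum_congr rfl fun u _ => ?_
    rw [eval_monomial, Finsupp.prod_fintype _ _ (by simp)]
    rfl
  have hcoeff := congrArg (coeff l) hpoly
  have hlmem : (⇑l) ∈ Finset.piAntidiag Finset.univ k := by
    simp [hk, Finsupp.degree_eq_sum]
  rw [coeff_C_mul, coeff_sum, Finset.sum_eq_single_of_mem _ hlmem, coeff_monomial,
    if_pos (by ext; rfl)] at hcoeff
  · have hspec : ((∏ i, (l i)! : ℕ) : ℝ) * (Nat.multinomial Finset.univ l : ℝ) = k ! := by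
      have := Nat.multinomial_spec Finset.univ (⇑l)
      rw [← Finsupp.degree_eq_sum, ← hk] at this
      exact_mod_cast this
    have hmul : (Nat.multinomial Finset.univ l : ℝ) ≠ 0 := by
      intro h
      rw [h, mul_zero] at hspec
      exact Nat.cast_ne_zero.2 (Nat.factorial_ne_zero k) hspec.symm
    rw [gaussMoment, ← hk]
    refine mul_left_cancel₀ hmul (hcoeff.trans ?_)
    rw [Algebra.algebraMap_self, RingHom.id_apply, hc]
    split_ifs with hev
    · rw [← hspec]
      push_cast
      ring
    · rw [coeff_covForm_pow_eq_zero, mul_zero, mul_zero, mul_zero]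
      intro h
      exact hev ⟨k / 2, by omega⟩
  · intro u _ hu
    rw [coeff_monomial, if_neg]
    rintro rfl
    exact hu rfl

end GaussianMoments

/-! ### Multilinearity of the mixed cumulant. -/

section Multilinear

variable {ι A : Type*} [Fintype ι] [DecidableEq ι] [CommRing A] [Algebra ℂ A]

/-- Exactly one block contains `i`, so each partition term is linear in the `i`-th argument. -/
theorem prod_parts_update (F : A →ₗ[ℂ] ℂ) (π : Finpartition (Finset.univ : Finset ι)) (q : ι → A)
    (i : ι) (x : A) :
    ∏ B ∈ π.parts, F (∏ j ∈ B, Function.update q i x j) =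
      F (x * ∏ j ∈ (π.part i).erase i, q j) *
        ∏ B ∈ π.parts.erase (π.part i), F (∏ j ∈ B, q j) := by
  have hi : i ∈ π.part i := π.mem_part_self.2 (Finset.mem_univ i)
  rw [← Finset.mul_prod_erase _ _ (π.part_mem.2 (Finset.mem_univ i))]
  congr 1
  · rw [← Finset.mul_prod_erase _ _ hi, Function.update_self]
    congr 2
    refine Finset.prod_congr rfl fun j hj => ?_
    rw [Function.update_of_ne (Finset.ne_of_mem_erase hj)]
  · refine Finset.prod_congr rfl fun B hB => ?_
    congr 1
    refine Finset.prod_congr rfl fun j hj => ?_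
    rw [Function.update_of_ne]
    rintro rfl
    exact Finset.ne_of_mem_erase hB (π.part_eq_of_mem (Finset.mem_of_mem_erase hB) hj).symm

/-- The mixed cumulant with respect to a linear functional, as a multilinear map. -/
noncomputable def cumulantMultilinear (F : A →ₗ[ℂ] ℂ) : MultilinearMap ℂ (fun _ : ι => A) ℂ :=
  MultilinearMap.mk' (fun q => cumulantOf fun B : Finset ι => F (∏ i ∈ B, q i))
    (fun q i x y => by
      simp only [cumulantOf, prod_parts_update, add_mul, map_add, mul_add, Finset.sum_add_distrib])
    (fun q i a x => by
      simp only [cumulantOf, prod_parts_update, smul_mul_assoc, map_smul, smul_eq_mul,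
        Finset.mul_sum]
      exact Finset.sum_congr rfl fun π _ => by ring)

theorem cumulantMultilinear_apply (F : A →ₗ[ℂ] ℂ) (q : ι → A) :
    cumulantMultilinear F q = cumulantOf fun B : Finset ι => F (∏ i ∈ B, q i) := rfl

theorem cumulantMultilinear_sum_smul {I : Type*} [Fintype I] (F : A →ₗ[ℂ] ℂ) (s : Finset ℕ)
    (a : ℕ → I → ℂ) (z : ℕ → I → A) :
    cumulantMultilinear F (fun _ : ι => ∑ k ∈ s, ∑ p, a k p • z k p) =
      ∑ l ∈ Fintype.piFinset fun _ : ι => s, ∑ x : ι → I,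
        (∏ i, a (l i) (x i)) * cumulantMultilinear F fun i => z (l i) (x i) := by
  classical
  rw [MultilinearMap.map_sum_finset (cumulantMultilinear F)
    (fun (_ : ι) k => ∑ p, a k p • z k p) fun _ => s]
  refine Finset.sum_congr rfl fun l _ => ?_
  rw [MultilinearMap.map_sum (cumulantMultilinear F) fun i p => a (l i) p • z (l i) p]
  refine Finset.sum_congr rfl fun x _ => ?_
  rw [MultilinearMap.map_smul_univ (cumulantMultilinear F) (fun i => a (l i) (x i))
    fun i => z (l i) (x i), smul_eq_mul]

end Multilinear

/-! ### Expectation as a linear functional on polynomials. -/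

section PolynomialExpectation

open MvPolynomial

variable {Ω I : Type*} [MeasurableSpace Ω] {P : Measure Ω} [Fintype I] {Y : I → Ω → ℝ}

theorem integrable_eval_of_gaussian (hY : HasGaussianLaw (fun ω p => Y p ω) P)
    (q : MvPolynomial I ℂ) : Integrable (fun ω => eval (fun p => (Y p ω : ℂ)) q) P := by
  simp_rw [eval_eq']
  refine integrable_finsetSum _ fun d _ => Integrable.const_mul ?_ _
  have := (integrable_prod_pow_of_gaussian hY d).ofReal (𝕜 := ℂ)
  simpa using this

/-- The expectation of a polynomial in a Gaussian vector. -/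
noncomputable def polyExpectation (hY : HasGaussianLaw (fun ω p => Y p ω) P) :
    MvPolynomial I ℂ →ₗ[ℂ] ℂ where
  toFun q := ∫ ω, eval (fun p => (Y p ω : ℂ)) q ∂P
  map_add' q₁ q₂ := by
    simp only [map_add]
    exact integral_add (integrable_eval_of_gaussian hY q₁) (integrable_eval_of_gaussian hY q₂)
  map_smul' a q := by
    simp only [smul_eval, RingHom.id_apply, smul_eq_mul]
    exact integral_const_mul _ _

theorem polyExpectation_apply (hY : HasGaussianLaw (fun ω p => Y p ω) P) (q : MvPolynomial I ℂ) :
    polyExpectation hY q = ∫ ω, eval (fun p => (Y p ω : ℂ)) q ∂P := rfl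

theorem cumulantMultilinear_powers {ι : Type*} [Fintype ι] [DecidableEq ι]
    (hY : HasGaussianLaw (fun ω p => Y p ω) P)
    (h0 : ∀ p, ∫ ω, Y p ω ∂P = 0) (l : ι → ℕ) (x : ι → I) :
    cumulantMultilinear (polyExpectation hY) (fun i => (X (x i) : MvPolynomial I ℂ) ^ l i) =
      (gaussCumulant (fun i j => cov[Y (x i), Y (x j); P]) (Finsupp.equivFunOnFinite.symm l) :
        ℝ) := by
  -- Here `x` may repeat indices; the resulting degenerate Gaussian law is allowed.
  have hX : HasGaussianLaw (fun ω i => Y (x i) ω) P :=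
    hY.map_fun (ContinuousLinearMap.pi fun i =>
      (ContinuousLinearMap.proj (R := ℝ) (x i) : (I → ℝ) →L[ℝ] ℝ))
  rw [cumulantMultilinear_apply, gaussCumulant, ← Complex.ofRealHom_eq_coe, map_cumulantOf]
  congr 1
  funext B
  rw [polyExpectation_apply, Complex.ofRealHom_eq_coe,
    ← integral_prod_pow_eq_gaussMoment (X := fun i => Y (x i)) hX fun i => h0 _,
    ← integral_complex_ofReal]
  congr 1
  funext ω
  simp only [map_prod, map_pow, eval_X, Complex.ofReal_prod, Complex.ofReal_pow]
  rw [← Finset.prod_subset (Finset.subset_univ B)]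
  · refine Finset.prod_congr rfl fun i hi => ?_
    simp [hi]
  · intro i _ hi
    simp [hi]

end PolynomialExpectation

/-! ### Sums of weights and decay over index pairs. -/

section PairSums

variable {n : ℕ}

/-- The weight `n` on the diagonal and `1` off the diagonal. -/
def pairWeight (e : Fin n × Fin n) : ℝ := if e.1 = e.2 then n else 1

/-- The decay of the covariances: `1` for intersecting pairs and `1 / n` for disjoint ones. -/
noncomputable def pairDecay (p q : PairIdx n) : ℝ :=
  if (p.verts ∩ q.verts).Nonempty then 1 else 1 / n

theorem pairWeight_nonneg (e : Fin n × Fin n) : 0 ≤ pairWeight e := by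
  unfold pairWeight
  split_ifs <;> positivity

theorem pairWeight_le (e : Fin n × Fin n) : pairWeight e ≤ (if e.1 = e.2 then (n : ℝ) else 0) + 1 := by
  unfold pairWeight
  split_ifs <;> simp

theorem sum_pairIdx_le {g : Fin n × Fin n → ℝ} (hg : ∀ e, 0 ≤ g e) :
    ∑ p : PairIdx n, g p.1 ≤ ∑ e, g e := by
  refine (Finset.sum_map Finset.univ
    (Function.Embedding.subtype fun e : Fin n × Fin n => e.1 ≤ e.2) g).symm.trans_le ?_
  exact Finset.sum_le_sum_of_subset_of_nonneg (Finset.subset_univ _) fun e _ _ => hg e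

theorem sum_pairWeight_le : ∑ e : Fin n × Fin n, pairWeight e ≤ 2 * (n : ℝ) ^ 2 := by
  refine (Finset.sum_le_sum fun e _ => pairWeight_le e).trans_eq ?_
  rw [Fintype.sum_prod_type]
  simp [Finset.sum_add_distrib]
  ring

theorem sum_pairWeight_left_le (x : Fin n) :
    ∑ e : Fin n × Fin n, pairWeight e * (if e.1 = x then 1 else 0) ≤ 2 * n := by
  refine (Finset.sum_le_sum fun e _ =>
    mul_le_mul_of_nonneg_right (pairWeight_le e) (by positivity)).trans_eq ?_
  rw [Fintype.sum_prod_type, Finset.sum_eq_single_of_mem x (Finset.mem_univ x)]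
  · simp [Finset.sum_add_distrib]
    ring
  · intro y _ hy
    simp [hy]

theorem sum_pairWeight_right_le (x : Fin n) :
    ∑ e : Fin n × Fin n, pairWeight e * (if e.2 = x then 1 else 0) ≤ 2 * n := by
  refine (Finset.sum_le_sum fun e _ =>
    mul_le_mul_of_nonneg_right (pairWeight_le e) (by positivity)).trans_eq ?_
  rw [Fintype.sum_prod_type_right, Finset.sum_eq_single_of_mem x (Finset.mem_univ x)]
  · simp [Finset.sum_add_distrib]
    ring
  · intro y _ hy
    simp [hy]

theorem pairDecay_nonneg (p q : PairIdx n) : 0 ≤ pairDecay p q := by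
  unfold pairDecay
  split_ifs <;> positivity

theorem pairDecay_le_one (hn : 1 ≤ n) (p q : PairIdx n) : pairDecay p q ≤ 1 := by
  unfold pairDecay
  split_ifs
  · exact le_rfl
  · exact div_le_one_of_le₀ (by exact_mod_cast hn) (by positivity)

theorem pairDecay_comm (p q : PairIdx n) : pairDecay p q = pairDecay q p := by
  rw [pairDecay, pairDecay, Finset.inter_comm]

theorem pairDecay_le (p q : PairIdx n) :
    pairDecay p q ≤ 1 / n +
      ∑ x ∈ p.verts, ((if q.1.1 = x then 1 else 0) + (if q.1.2 = x then (1 : ℝ) else 0)) := by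
  have hnn : ∀ x ∈ p.verts,
      0 ≤ ((if q.1.1 = x then 1 else 0) + (if q.1.2 = x then (1 : ℝ) else 0)) :=
    fun x _ => by positivity
  unfold pairDecay
  split_ifs with h
  · obtain ⟨x, hx⟩ := h
    rw [Finset.mem_inter] at hx
    have h1 : (1 : ℝ) ≤ (if q.1.1 = x then 1 else 0) + (if q.1.2 = x then (1 : ℝ) else 0) := by
      have := hx.2
      simp only [PairIdx.verts, Finset.mem_insert, Finset.mem_singleton] at this
      rcases this with rfl | rfl
      · rw [if_pos rfl]
        exact le_add_of_nonneg_right (by positivity)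
      · rw [if_pos (rfl : q.1.2 = q.1.2)]
        exact le_add_of_nonneg_left (by positivity)
    exact (h1.trans (Finset.single_le_sum hnn hx.1)).trans
      (le_add_of_nonneg_left (by positivity))
  · exact le_add_of_nonneg_right (Finset.sum_nonneg hnn)

/-- The uniform `1 / n` against total weight `2 n ^ 2` gives `2 n`; each of the at most two vertices
of `p` gives `2 n + 2 n`, one for either position in `q`. Together this is `10 n`. -/
theorem sum_pairWeight_mul_pairDecay_le (hn : 1 ≤ n) (p : PairIdx n) :
    ∑ q : PairIdx n, pairWeight q.1 * pairDecay p q ≤ 10 * n := by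
  have hn0 : (0 : ℝ) < n := by exact_mod_cast hn
  have hcard : (p.verts.card : ℝ) ≤ 2 := by exact_mod_cast Finset.card_le_two
  calc _ ≤ ∑ q : PairIdx n, pairWeight q.1 * (1 / n +
        ∑ x ∈ p.verts, ((if q.1.1 = x then 1 else 0) + (if q.1.2 = x then (1 : ℝ) else 0))) :=
        Finset.sum_le_sum fun q _ =>
          mul_le_mul_of_nonneg_left (pairDecay_le p q) (pairWeight_nonneg _)
    _ ≤ ∑ e : Fin n × Fin n, pairWeight e * (1 / n +
        ∑ x ∈ p.verts, ((if e.1 = x then 1 else 0) + (if e.2 = x then (1 : ℝ) else 0))) :=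
        sum_pairIdx_le (g := fun e : Fin n × Fin n => pairWeight e * (1 / n +
          ∑ x ∈ p.verts, ((if e.1 = x then 1 else 0) + (if e.2 = x then (1 : ℝ) else 0))))
          fun e => mul_nonneg (pairWeight_nonneg e)
            (add_nonneg (by positivity) (Finset.sum_nonneg fun x _ => by positivity))
    _ = (∑ e : Fin n × Fin n, pairWeight e) * (1 / n) +
        ∑ x ∈ p.verts, (∑ e : Fin n × Fin n, pairWeight e * (if e.1 = x then 1 else 0) +
          ∑ e : Fin n × Fin n, pairWeight e * (if e.2 = x then 1 else 0)) := by
        simp only [mul_add, Finset.sum_add_distrib, Finset.mul_sum, Finset.sum_mul]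
        congr 2 <;> exact Finset.sum_comm
    _ ≤ 2 * (n : ℝ) ^ 2 * (1 / n) + ∑ x ∈ p.verts, (2 * (n : ℝ) + 2 * n) := by
        gcongr with x _
        · exact sum_pairWeight_le
        · exact sum_pairWeight_left_le x
        · exact sum_pairWeight_right_le x
    _ = 2 * n + p.verts.card * (4 * n) := by
        rw [Finset.sum_const, nsmul_eq_mul]
        field_simp
        ring
    _ ≤ 2 * n + 2 * (4 * n) := by gcongr
    _ = _ := by ring

end PairSums

/-! ### Coefficients and the maximum over even tuples. -/

section PairPolynomial

open MvPolynomial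

variable {n : ℕ}

/-- The coefficient of `Y p ^ k` in `pairPolynomial`. -/
def pairCoeff (c₁ : Fin n → ℂ) (c₂ : PairIdx n → ℂ) (c : ℕ → PairIdx n → ℂ) (k : ℕ)
    (p : PairIdx n) : ℂ :=
  if k = 1 then (if p.1.1 = p.1.2 then c₁ p.1.1 else 0)
  else if k = 2 then c₂ p
  else if p.1.1 < p.1.2 then c k p else 0

theorem pairIdx_eq_diag {p : PairIdx n} (h : p.1.1 = p.1.2) : p = PairIdx.diag p.1.1 :=
  Subtype.ext (Prod.ext rfl h.symm)

theorem eval_sum_pairCoeff {Ω : Type*} {L : ℕ} (hL : 2 ≤ L) (Y : PairIdx n → Ω → ℝ)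
    (c₁ : Fin n → ℂ) (c₂ : PairIdx n → ℂ) (c : ℕ → PairIdx n → ℂ) (ω : Ω) :
    eval (fun p => (Y p ω : ℂ))
      (∑ k ∈ Finset.Icc 1 L, ∑ p, pairCoeff c₁ c₂ c k p • (X p : MvPolynomial (PairIdx n) ℂ) ^ k) =
      pairPolynomial L Y c₁ c₂ c ω := by
  simp only [map_sum, smul_eval, map_pow, eval_X]
  have hIcc : Finset.Icc 1 L = insert 1 (insert 2 (Finset.Icc 3 L)) := by
    ext k
    simp only [Finset.mem_Icc, Finset.mem_insert]
    omega
  rw [hIcc, Finset.sum_insert (by simp), Finset.sum_insert (by simp), pairPolynomial, ← add_assoc]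
  congr 1
  · congr 1
    simp only [pairCoeff, if_true, pow_one, ite_mul, zero_mul]
    rw [← Finset.sum_filter]
    symm
    refine Finset.sum_bij (fun j _ => PairIdx.diag j) ?_ ?_ ?_ ?_
    · intro j _
      simp [PairIdx.diag]
    · intro j _ k _ h
      exact congrArg (fun p : PairIdx n => p.1.1) h
    · intro p hp
      exact ⟨p.1.1, Finset.mem_univ _, (pairIdx_eq_diag (Finset.mem_filter.1 hp).2).symm⟩
    · intro j _
      rfl
  · refine Finset.sum_congr rfl fun k hk => ?_
    have := (Finset.mem_Icc.1 hk).1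
    rw [Finset.sum_filter]
    refine Finset.sum_congr rfl fun p _ => ?_
    rw [pairCoeff, if_neg (by omega), if_neg (by omega), ite_mul, zero_mul]

/-- Truncation at `0` is needed because `C k` may be negative when no coefficient is bounded by it,
as for `k ≥ 3` and `n = 1`. -/
theorem norm_pairCoeff_le {L : ℕ} {C : ℕ → ℝ} {c₁ : Fin n → ℂ}
    {c₂ : PairIdx n → ℂ} {c : ℕ → PairIdx n → ℂ}
    (h₁ : ∀ j, ‖c₁ j‖ ≤ n * C 1) (h₂ : ∀ j, ‖c₂ (PairIdx.diag j)‖ ≤ n * C 2)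
    (h₂' : ∀ p : PairIdx n, p.1.1 < p.1.2 → ‖c₂ p‖ ≤ C 2)
    (h₃ : ∀ k, 3 ≤ k → k ≤ L → ∀ p : PairIdx n, p.1.1 < p.1.2 → ‖c k p‖ ≤ C k)
    {k : ℕ} (hk : k ∈ Finset.Icc 1 L) (p : PairIdx n) :
    ‖pairCoeff c₁ c₂ c k p‖ ≤ max (C k) 0 * pairWeight p.1 := by
  have hk := Finset.mem_Icc.1 hk
  have hnn : 0 ≤ max (C k) 0 * pairWeight p.1 :=
    mul_nonneg (le_max_right _ _) (pairWeight_nonneg _)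
  rcases eq_or_lt_of_le p.2 with hp | hp
  · have hw : pairWeight p.1 = n := if_pos hp
    have hle : n * C k ≤ max (C k) 0 * pairWeight p.1 := by
      rw [hw, mul_comm]
      exact mul_le_mul_of_nonneg_right (le_max_left _ _) (Nat.cast_nonneg n)
    unfold pairCoeff
    split_ifs with hk1 hk2
    · subst hk1
      exact (h₁ _).trans hle
    · subst hk2
      rw [pairIdx_eq_diag hp] at hle ⊢
      exact (h₂ _).trans hle
    · exact absurd hp (ne_of_lt ‹_›)
    · simpa using hnn
  · have hw : pairWeight p.1 = 1 := if_neg hp.ne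
    have hle : C k ≤ max (C k) 0 * pairWeight p.1 := by
      rw [hw, mul_one]
      exact le_max_left _ _
    unfold pairCoeff
    split_ifs with hk1 hp1 hk2
    · exact absurd hp1 hp.ne
    · simpa using hnn
    · subst hk2
      exact (h₂' p hp).trans hle
    · exact (h₃ k (by omega) hk.2 p hp).trans hle

/-- If some truncation is active the product is `0`, and the even tuple `(2, …, 2)` shows that the
maximum is nonnegative. -/
theorem prod_max_le_maxCoeffProduct {r L : ℕ} (hL : 2 ≤ L) {C : ℕ → ℝ} (hC : 0 ≤ C 2)
    {l : Fin r → ℕ} (hl : l ∈ evenTuples r L) :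
    ∏ i, max (C (l i)) 0 ≤ maxCoeffProduct r hL C := by
  by_cases h : ∀ i, 0 ≤ C (l i)
  · rw [Finset.prod_congr rfl fun i _ => max_eq_left (h i)]
    exact Finset.le_sup' (fun l => ∏ i, C (l i)) hl
  · push Not at h
    obtain ⟨i, hi⟩ := h
    rw [Finset.prod_eq_zero (Finset.mem_univ i) (max_eq_right hi.le)]
    have h2 : (fun _ => 2) ∈ evenTuples r L := by simp [evenTuples, hL]
    exact (Finset.prod_nonneg fun _ _ => hC).trans
      (Finset.le_sup' (fun l : Fin r → ℕ => ∏ i, C (l i)) h2)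

end PairPolynomial

/-! ### Assembling the bound. -/

section CumulantBound

open MvPolynomial

theorem norm_cumulant_pairPolynomial_le {Ω : Type*} [MeasurableSpace Ω] {P : Measure Ω} {n : ℕ}
    {Y : PairIdx n → Ω → ℝ} (hY : HasGaussianLaw (fun ω p => Y p ω) P)
    (h0 : ∀ p, ∫ ω, Y p ω ∂P = 0) {r L : ℕ} (hL : 2 ≤ L)
    (c₁ : Fin n → ℂ) (c₂ : PairIdx n → ℂ) (c : ℕ → PairIdx n → ℂ) :
    ‖cumulant P r (pairPolynomial L Y c₁ c₂ c)‖ ≤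
      ∑ l ∈ Fintype.piFinset fun _ : Fin r => Finset.Icc 1 L, ∑ x : Fin r → PairIdx n,
        (∏ i, ‖pairCoeff c₁ c₂ c (l i) (x i)‖) *
          |gaussCumulant (fun i j => cov[Y (x i), Y (x j); P]) (Finsupp.equivFunOnFinite.symm l)| := by
  have h : cumulant P r (pairPolynomial L Y c₁ c₂ c) =
      cumulantMultilinear (polyExpectation hY) fun _ : Fin r =>
        ∑ k ∈ Finset.Icc 1 L, ∑ p, pairCoeff c₁ c₂ c k p •
          (X p : MvPolynomial (PairIdx n) ℂ) ^ k := by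
    simp only [cumulantMultilinear_apply, polyExpectation_apply, map_prod,
      eval_sum_pairCoeff hL, cumulant]
    rfl
  rw [h, cumulantMultilinear_sum_smul _ _ (pairCoeff c₁ c₂ c)
    fun k p => (X p : MvPolynomial (PairIdx n) ℂ) ^ k]
  refine (norm_sum_le _ _).trans (Finset.sum_le_sum fun l _ => ?_)
  refine (norm_sum_le _ _).trans (Finset.sum_le_sum fun x _ => ?_)
  rw [norm_mul, norm_prod, cumulantMultilinear_powers hY h0, Complex.norm_real, Real.norm_eq_abs]

theorem sum_pairWeight_gaussCumulant_le {n r : ℕ} (hn : 1 ≤ n) (hr : 1 ≤ r) {A : ℝ} (hA : 0 ≤ A)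
    {s : PairIdx n → PairIdx n → ℝ} (hs : ∀ p q, |s p q| ≤ A * pairDecay p q)
    (l : Fin r →₀ ℕ) :
    ∑ x : Fin r → PairIdx n, (∏ i, pairWeight (x i).1) *
        |gaussCumulant (fun i j => s (x i) (x j)) l| ≤
      gaussCumulantConst l A * (2 * 10 ^ (r - 1)) * (n : ℝ) ^ (r + 1) := by
  have hn0 : (0 : ℝ) < n := by exact_mod_cast hn
  have : Nonempty (Fin r) := ⟨⟨0, hr⟩⟩
  have hsum : ∑ p : PairIdx n, pairWeight p.1 ≤ 2 * (n : ℝ) ^ 2 :=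
    (sum_pairIdx_le pairWeight_nonneg).trans sum_pairWeight_le
  have hpos : 0 < ∑ p : PairIdx n, pairWeight p.1 := by
    refine Finset.sum_pos' (fun p _ => pairWeight_nonneg _)
      ⟨PairIdx.diag ⟨0, hn⟩, Finset.mem_univ _, ?_⟩
    simpa [pairWeight, PairIdx.diag] using Nat.pos_of_ne_zero (by omega)
  refine (sum_abs_gaussCumulant_le hA (fun p => pairWeight_nonneg p.1) hpos pairDecay_nonneg
    (pairDecay_le_one hn) pairDecay_comm (sum_pairWeight_mul_pairDecay_le hn) (by positivity)
    hs l).trans ?_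
  rw [Fintype.card_fin, mul_assoc]
  refine mul_le_mul_of_nonneg_left ?_ (gaussCumulantConst_nonneg l hA)
  refine (mul_le_mul_of_nonneg_right hsum (by positivity)).trans_eq ?_
  obtain ⟨m, rfl⟩ := Nat.exists_eq_add_of_le' hr
  rw [Nat.add_sub_cancel, mul_pow]
  ring

end CumulantBound

/-- The constant `K` depends only on the bounds `R` for `r` and `L₀` for `L`, and on the constant `A`
in the covariance bounds. -/
theorem theorem2p4 (R L₀ : ℕ) (A : ℝ) :
    ∃ K : ℝ, ∀ (r L : ℕ) (_ : 1 ≤ r) (_ : r ≤ R) (hL : 2 ≤ L) (_ : L ≤ L₀)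
      (n : ℕ) (_ : 1 ≤ n)
      (Ω : Type*) [MeasurableSpace Ω] (P : Measure Ω) [IsProbabilityMeasure P]
      (Y : PairIdx n → Ω → ℝ)
      (_ : HasGaussianLaw (fun ω p => Y p ω) P)
      (_ : ∀ p, ∫ ω, Y p ω ∂P = 0)
      (_ : ∀ p q : PairIdx n, (p.verts ∩ q.verts).Nonempty → |cov[Y p, Y q; P]| ≤ A)
      (_ : ∀ p q : PairIdx n, p.verts ∩ q.verts = ∅ → |cov[Y p, Y q; P]| ≤ A / n)
      (C : ℕ → ℝ) (c₁ : Fin n → ℂ) (c₂ : PairIdx n → ℂ) (c : ℕ → PairIdx n → ℂ)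
      (_ : ∀ j, ‖c₁ j‖ ≤ n * C 1)
      (_ : ∀ j, ‖c₂ (PairIdx.diag j)‖ ≤ n * C 2)
      (_ : ∀ p : PairIdx n, p.1.1 < p.1.2 → ‖c₂ p‖ ≤ C 2)
      (_ : ∀ ℓ, 3 ≤ ℓ → ℓ ≤ L → ∀ p : PairIdx n, p.1.1 < p.1.2 → ‖c ℓ p‖ ≤ C ℓ),
      ‖cumulant P r (pairPolynomial L Y c₁ c₂ c)‖
        ≤ K * (n : ℝ) ^ (r + 1) * maxCoeffProduct r hL C := by
  classical
  -- The factor `2 * 10 ^ (r - 1)` comes from `2 n ^ 2 * (10 n) ^ (r - 1)`.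
  let K₁ : (r : ℕ) → (Fin r → ℕ) → ℝ := fun r l =>
    gaussCumulantConst (Finsupp.equivFunOnFinite.symm l) A * (2 * 10 ^ (r - 1))
  let K₂ : ℕ → ℝ := fun r =>
    ∑ l ∈ Fintype.piFinset fun _ : Fin r => Finset.Icc 1 L₀, K₁ r l
  refine ⟨∑ r ∈ Finset.range (R + 1), K₂ r, ?_⟩
  intro r L hr hrR hL hLL n hn Ω _ P _ Y hY h0 hA₁ hA₂ C c₁ c₂ c h₁ h₂ h₂' h₃
  have hn0 : (0 : ℝ) < n := by exact_mod_cast hn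
  -- Since `n ≥ 1` there is a diagonal pair, whose variance bound forces `A ≥ 0`; likewise `C 2 ≥ 0`
  -- below.
  have hA : 0 ≤ A := by
    refine (abs_nonneg _).trans (hA₁ (PairIdx.diag ⟨0, hn⟩) (PairIdx.diag ⟨0, hn⟩) ?_)
    exact ⟨⟨0, hn⟩, by simp [PairIdx.verts, PairIdx.diag]⟩
  have hC : 0 ≤ C 2 := by
    have := (norm_nonneg _).trans (h₂ ⟨0, hn⟩)
    exact nonneg_of_mul_nonneg_right this hn0
  have hs : ∀ p q, |cov[Y p, Y q; P]| ≤ A * pairDecay p q := by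
    intro p q
    unfold pairDecay
    split_ifs with h
    · simpa using hA₁ p q h
    · simpa [div_eq_mul_inv] using hA₂ p q (Finset.not_nonempty_iff_eq_empty.1 h)
  have hK₁ : ∀ r l, 0 ≤ K₁ r l := fun r l =>
    mul_nonneg (gaussCumulantConst_nonneg _ hA) (by positivity)
  have hmax : 0 ≤ maxCoeffProduct r hL C := by
    refine le_trans ?_ (prod_max_le_maxCoeffProduct hL hC (l := fun _ => 2)
      (by simp [evenTuples, hL]))
    exact Finset.prod_nonneg fun _ _ => le_max_right _ _
  have hterm : ∀ l ∈ Fintype.piFinset fun _ : Fin r => Finset.Icc 1 L,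
      ∑ x : Fin r → PairIdx n, (∏ i, ‖pairCoeff c₁ c₂ c (l i) (x i)‖) *
          |gaussCumulant (fun i j => cov[Y (x i), Y (x j); P]) (Finsupp.equivFunOnFinite.symm l)| ≤
        K₁ r l * ((n : ℝ) ^ (r + 1) * maxCoeffProduct r hL C) := by
    intro l hl
    by_cases hev : Even (∑ i, l i)
    · have hprod := prod_max_le_maxCoeffProduct hL hC
        (l := l) (by simp only [evenTuples, Finset.mem_filter]; exact ⟨hl, hev⟩)
      calc _ ≤ ∑ x : Fin r → PairIdx n, (∏ i, max (C (l i)) 0) * ((∏ i, pairWeight (x i).1) *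
            |gaussCumulant (fun i j => cov[Y (x i), Y (x j); P])
              (Finsupp.equivFunOnFinite.symm l)|) := by
            refine Finset.sum_le_sum fun x _ => ?_
            rw [← mul_assoc, ← Finset.prod_mul_distrib]
            refine mul_le_mul_of_nonneg_right ?_ (abs_nonneg _)
            refine Finset.prod_le_prod (fun i _ => norm_nonneg _) fun i _ => ?_
            exact norm_pairCoeff_le h₁ h₂ h₂' h₃ (Fintype.mem_piFinset.1 hl i) _
        _ ≤ maxCoeffProduct r hL C * (K₁ r l * (n : ℝ) ^ (r + 1)) := by
            rw [← Finset.mul_sum]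
            refine mul_le_mul hprod (sum_pairWeight_gaussCumulant_le hn hr hA hs _) ?_ hmax
            exact Finset.sum_nonneg fun x _ => mul_nonneg
              (Finset.prod_nonneg fun i _ => pairWeight_nonneg _) (abs_nonneg _)
        _ = _ := by ring
    · refine le_of_eq_of_le (Finset.sum_eq_zero fun x _ => ?_)
        (mul_nonneg (hK₁ r l) (by positivity))
      rw [gaussCumulant_eq_zero_of_odd, abs_zero, mul_zero]
      rw [Finsupp.degree_eq_sum]
      exact Nat.not_even_iff_odd.1 hev
  calc _ ≤ ∑ l ∈ Fintype.piFinset fun _ : Fin r => Finset.Icc 1 L,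
        K₁ r l * ((n : ℝ) ^ (r + 1) * maxCoeffProduct r hL C) :=
        (norm_cumulant_pairPolynomial_le hY h0 hL c₁ c₂ c).trans (Finset.sum_le_sum hterm)
    _ ≤ K₂ r * ((n : ℝ) ^ (r + 1) * maxCoeffProduct r hL C) := by
        rw [← Finset.sum_mul]
        refine mul_le_mul_of_nonneg_right ?_ (by positivity)
        refine Finset.sum_le_sum_of_subset_of_nonneg ?_ fun l _ _ => hK₁ r l
        exact Fintype.piFinset_subset _ _ fun _ => Finset.Icc_subset_Icc_right hLL
    _ ≤ (∑ r ∈ Finset.range (R + 1), K₂ r) * ((n : ℝ) ^ (r + 1) * maxCoeffProduct r hL C) := by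
        refine mul_le_mul_of_nonneg_right ?_ (by positivity)
        exact Finset.single_le_sum (f := K₂) (fun r _ => Finset.sum_nonneg fun l _ => hK₁ r l)
          (Finset.mem_range.2 (by omega))
    _ = _ := by ring
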